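/- Let $\mathbf{k}$ be a field. For a set $Z$ let $\mathcal M(Z)$ be the free monoid and $\mathfrak M(Z)\supseteq \mathcal M(Z)$ the free operated monoid on $Z$ (bracketed words, with operator $u\mapsto\lfloor u\rfloor$), so that $\mathbf{k}\mathfrak M(Z)$, with the linear extension $P$ of $\lfloor\ \rfloor$, is the free unital operated $\mathbf{k}$-algebra on $Z$. Let $\mathfrak M^\star(Z)$ be the set of bracketed words on $Z\sqcup\{\star\}$ in which $\star$ occurs exactly once, and for $q\in\mathfrak M^\star(Z)$ let $q|_u$ be the result of replacing $\star$ by $u$, extended linearly in $u$. Let $\langle S\rangle$ denote the operated ideal (two-sided ideal closed under $P$) generated by $S$. **Identities of Rota–Baxter type.** For $\phi\in\mathbf{k}\mathfrak M(\{x,y\})$, a $\phi$-algebra is a unital $\mathbf{k}$-algebra $R$ with a linear operator such that $\phi(a,b)=0$ for all $a,b\in R$. Put $S_\phi(Z)=\{\phi(u,v): u,v\in\mathfrak M(Z)\}$. We say that $\phi$ is of Rota–Baxter type if $\phi=\lfloor x\rfloor\lfloor y\rfloor-\lfloor B(x,y)\rfloor$, where (a) $x$ and $y$ each occur exactly once in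 every monomial of $B$; (b) no monomial of $B$ has a subword $\lfloor u\rfloor\lfloor v\rfloor$ with $u,v\neq1$; (c) for every set $Z$ the rewriting system on $\mathbf{k}\mathfrak M(Z)$ with the rules $q|_{\lfloor u\rfloor\lfloor v\rfloor}\to q|_{\lfloor B(u,v)\rfloor}$ ($u,v\in\mathfrak M(Z)$, $q\in\mathfrak M^\star(Z)$) is terminating; (d) for every set $Z$ and all $u,v,w\in\mathfrak M(Z)\setminus\{1\}$, the element $B(B(u,v),w)-B(u,B(v,w))$ rewrites to $0$ in this system. **Gröbner–Shirshov bases.** A monomial order on $\mathfrak M(Z)$ is a well-order such that $u<v$ implies $q|_u<q|_v$. Let $\bar f$ be the leading monomial of $f$ ($\bar f=1$ if $f=0$) and $|u|$ the number of factors of $u$ in $Z\cup\lfloor\mathfrak M(Z)\rfloor$. An element is trivial modulo $(S,w)$ if it is a finite sum $\sum_i c_i\,q_i|_{s_i}$ with $c_i\in\mathbf{k}$, $s_i\in S$ and $q_i|_{\bar s_i}<w$. A set $S$ is an operated Gröbner–Shirshov (GS) basis of $J$ if $\langle S\rangle=J$ and if, for all nonzero $f,g\in S$ divided by their leading coefficients,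 all compositions $fu-vg$ with $w=\bar fu=v\bar g$ and $\max(|\bar f|,|\bar g|)<|w|<|\bar f|+|\bar g|$, and all compositions $f-q|_g$ with $w=\bar f=q|_{\bar g}$, are trivial modulo $(S,w)$. GS bases of two-sided ideals of $\mathbf{k}\mathcal M(Z)$ are defined in the same way, with $q=a\star b$, $a,b\in\mathcal M(Z)$. **Orders.** Given a well-order on $Z$, let $\le_{\rm dlex}$ be the degree lexicographical order on $\mathcal M(Z)$. Every $u\in\mathfrak M(Z)$ is uniquely $u_0\lfloor u_1^*\rfloor u_1\cdots\lfloor u_r^*\rfloor u_r$ with $u_i\in\mathcal M(Z)$ and $u_i^*\in\mathfrak M(Z)$. The order $\le_{\rm db}$ on $\mathfrak M(Z)$ compares first the total number of operators $\lfloor\ \rfloor$, then $r$, then the tuples $(u_1^*,\dots,u_r^*,u_0,\dots,u_r)$ lexicographically, where the $u_i^*$ are compared recursively by $\le_{\rm db}$ and the $u_i$ by $\le_{\rm dlex}$. The same definition with $x<y$ gives $\le_{\rm db}$ on $\mathfrak M(\{x,y\})$. **Theorem.** Let $Z$ be a set, $I_A$ a two-sided ideal of $\mathbf{k}\mathcal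 M(Z)$, $A=\mathbf{k}\mathcal M(Z)/I_A$, and $\phi$ of Rota–Baxter type. 1. $\mathbf{k}\mathfrak M(Z)/\langle S_\phi(Z)\cup I_A\rangle$, together with the homomorphism from $A$ induced by the inclusion $\mathbf{k}\mathcal M(Z)\subseteq\mathbf{k}\mathfrak M(Z)$, is the free $\phi$-algebra over the unital algebra $A$: it is a $\phi$-algebra, and every homomorphism of unital algebras from $A$ to a $\phi$-algebra factors uniquely through it by a morphism of operated algebras. 2. For every well-order on $Z$, $\le_{\rm db}$ is a monomial order on $\mathfrak M(Z)$ which restricts to $\le_{\rm dlex}$ on $\mathcal M(Z)$. Let $G$ be a GS basis of $I_A$ with respect to $\le_{\rm dlex}$. If $\lfloor x\rfloor\lfloor y\rfloor$ is the leading monomial of $\phi$ with respect to $\le_{\rm db}$, then $S_\phi(Z)\cup G$ is an operated GS basis of $\langle S_\phi(Z)\cup I_A\rangle$ with respect to $\le_{\rm db}$. More generally, $S_\phi(Z)\cup G$ is an operated GS basis of $\langle S_\phi(Z)\cup I_A\rangle$ with respect to every monomial order $\le$ on $\mathfrak M(Z)$ which restricts to $\le_{\rm dlex}$ and satisfies $m(u,v)<\lfloor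 u\rfloor\lfloor v\rfloor$ for all $u,v\in\mathfrak M(Z)$ and every monomial $m\ne\lfloor x\rfloor\lfloor y\rfloor$ of $\phi$. -/

import Mathlib

open MonoidAlgebra

namespace OperatedGS

/-! ### Bracketed words: the free operated monoid `𝔐(Z)` -/

/-- The free operated monoid `𝔐(Z)` of bracketed words on `Z`.  A bracketed word is a finite
product of factors, each of which is a letter `z ∈ Z` or a bracket `⌊u⌋` with `u` a bracketed word.
`one` is the empty word, `letter z w` is `z w`, and `bracket u w` is `⌊u⌋ w`. -/
inductive BWord (Z : Type*) where
  | one : BWord Z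
  | letter : Z → BWord Z → BWord Z
  | bracket : BWord Z → BWord Z → BWord Z

namespace BWord

variable {Z : Type*}

/-- Concatenation of bracketed words. -/
def append : BWord Z → BWord Z → BWord Z
  | one, v => v
  | letter z w, v => letter z (append w v)
  | bracket u w, v => bracket u (append w v)

instance : One (BWord Z) := ⟨one⟩

instance : Mul (BWord Z) := ⟨append⟩

theorem one_eq : (one : BWord Z) = 1 := rfl

theorem letter_mul (z : Z) (w v : BWord Z) : letter z w * v = letter z (w * v) := rfl

theorem bracket_mul (u w v : BWord Z) : bracket u w * v = bracket u (w * v) := rfl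

instance : Monoid (BWord Z) where
  mul_assoc a b c := by
    induction a with
    | one => rfl
    | letter z w ih => simp only [letter_mul, ih]
    | bracket u w _ ih => simp only [bracket_mul, ih]
  one_mul _ := rfl
  mul_one a := by
    induction a with
    | one => rfl
    | letter z w ih => simp only [letter_mul, ih]
    | bracket u w _ ih => simp only [bracket_mul, ih]

/-- The one-letter word `z`. -/
def var (z : Z) : BWord Z := letter z 1

/-- The operator `u ↦ ⌊u⌋` of the free operated monoid. -/
def br (u : BWord Z) : BWord Z := bracket u 1

/-- The inclusion of the free monoid `𝓜(Z)` into `𝔐(Z)`. -/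
def ofFree (Z : Type*) : FreeMonoid Z →* BWord Z := FreeMonoid.lift var

/-- The unique morphism of operated monoids from `𝔐(Z)` to the operated monoid `(M, P)` which
extends `θ : Z → M`. -/
def eval {M : Type*} [Monoid M] (P : M → M) (θ : Z → M) : BWord Z → M
  | one => 1
  | letter z w => θ z * eval P θ w
  | bracket u w => P (eval P θ u) * eval P θ w

theorem eval_mul {M : Type*} [Monoid M] (P : M → M) (θ : Z → M) (a b : BWord Z) :
    eval P θ (a * b) = eval P θ a * eval P θ b := by
  induction a with
  | one => exact (one_mul _).symm
  | letter z w ih => simp only [letter_mul, eval, ih, mul_assoc]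
  | bracket u w _ ih => simp only [bracket_mul, eval, ih, mul_assoc]

/-- `eval` as a homomorphism of monoids. -/
def evalHom {M : Type*} [Monoid M] (P : M → M) (θ : Z → M) : BWord Z →* M where
  toFun := eval P θ
  map_one' := rfl
  map_mul' := eval_mul P θ

/-- The number of occurrences of the letter `z`. -/
def count [DecidableEq Z] (z : Z) : BWord Z → ℕ
  | one => 0
  | letter y w => (if y = z then 1 else 0) + count z w
  | bracket u w => count z u + count z w

/-- The breadth `|u|`: the number of factors of `u` in `Z ∪ ⌊𝔐(Z)⌋`. -/
def breadth : BWord Z → ℕ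
  | one => 0
  | letter _ w => 1 + breadth w
  | bracket _ w => 1 + breadth w

/-- The number of all occurrences of the operator `⌊ ⌋` in a word, at any depth. -/
def degP : BWord Z → ℕ
  | one => 0
  | letter _ w => degP w
  | bracket u w => 1 + degP u + degP w

/-- The list `[u₁*, …, uᵣ*]` in the factorisation `u = u₀ ⌊u₁*⌋ u₁ ⌊u₂*⌋ ⋯ ⌊uᵣ*⌋ uᵣ` with
`u₀, …, uᵣ ∈ 𝓜(Z)`. -/
def inner : BWord Z → List (BWord Z)
  | one => []
  | letter _ w => inner w
  | bracket u w => u :: inner w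

/-- The list `[u₀, …, uᵣ]` in the factorisation `u = u₀ ⌊u₁*⌋ u₁ ⌊u₂*⌋ ⋯ ⌊uᵣ*⌋ uᵣ` with
`u₀, …, uᵣ ∈ 𝓜(Z)`. -/
def outer : BWord Z → List (FreeMonoid Z)
  | one => [1]
  | letter z w => (outer w).modifyHead (FreeMonoid.of z * ·)
  | bracket _ w => 1 :: outer w

/-- The number `r` in the factorisation `u = u₀ ⌊u₁*⌋ u₁ ⌊u₂*⌋ ⋯ ⌊uᵣ*⌋ uᵣ`. -/
def breadthP (u : BWord Z) : ℕ := (inner u).length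

end BWord

open BWord

/-! ### Contexts: words with exactly one occurrence of `⋆` -/

/-- The set `𝔐^⋆(Z)` of bracketed words on `Z ∪ {⋆}` in which `⋆` occurs exactly once.  Such a word
is uniquely of the form `a ⋆ b` (`hole a b`) or `a ⌊q⌋ b` (`nest a q b`), with `a, b ∈ 𝔐(Z)` and
`q ∈ 𝔐^⋆(Z)`. -/
inductive Ctx (Z : Type*) where
  | hole : BWord Z → BWord Z → Ctx Z
  | nest : BWord Z → Ctx Z → BWord Z → Ctx Z

/-- The word `q|_u` obtained by replacing `⋆` in `q` by `u`. -/
def Ctx.app {Z : Type*} : Ctx Z → BWord Z → BWord Z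
  | .hole a b, u => a * u * b
  | .nest a q b, u => a * br (q.app u) * b

/-- The context `a ⋆ b` in the free monoid `𝓜(Z)`. -/
def freeApp {Z : Type*} (q : FreeMonoid Z × FreeMonoid Z) (u : FreeMonoid Z) : FreeMonoid Z :=
  q.1 * u * q.2

/-! ### Operated algebras

An operated unital `k`-algebra is a `k`-algebra `A` together with a `k`-linear map `P : A → A`. -/

section Algebras

variable {k : Type*} [Field k]

/-- The operator of the free operated algebra `k𝔐(Z)`: the linear extension of `u ↦ ⌊u⌋`. -/
noncomputable def freeP (k : Type*) [Field k] (Z : Type*) :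
    MonoidAlgebra k (BWord Z) →ₗ[k] MonoidAlgebra k (BWord Z) :=
  MonoidAlgebra.mapDomainLinearMap k k br

/-- The inclusion `k𝓜(Z) → k𝔐(Z)`. -/
noncomputable def incl (k : Type*) [Field k] (Z : Type*) :
    MonoidAlgebra k (FreeMonoid Z) →ₐ[k] MonoidAlgebra k (BWord Z) :=
  MonoidAlgebra.mapDomainAlgHom k k (ofFree Z)

/-- The morphism of operated algebras from `k𝔐(X)` to `(A, P)` which extends `θ : X → A`; its value
at `φ(x₁, …, xₙ)` is `φ(θ x₁, …, θ xₙ)`. -/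
noncomputable def evalAlg {X A : Type*} [Ring A] [Algebra k A] (P : A →ₗ[k] A) (θ : X → A) :
    MonoidAlgebra k (BWord X) →ₐ[k] A :=
  MonoidAlgebra.lift k A (BWord X) (evalHom P θ)

/-- `(A, P)` is a `φ`-algebra: it satisfies the operated polynomial identity `φ`. -/
def IsPhiAlgebra {X A : Type*} [Ring A] [Algebra k A] (φ : MonoidAlgebra k (BWord X))
    (P : A →ₗ[k] A) : Prop :=
  ∀ θ : X → A, evalAlg P θ φ = 0

/-- The set `S_φ(Z)` of all `φ(u₁, …, uₙ)` with `u₁, …, uₙ ∈ 𝔐(Z)`. -/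
def phiSet {X : Type*} (φ : MonoidAlgebra k (BWord X)) (Z : Type*) :
    Set (MonoidAlgebra k (BWord Z)) :=
  Set.range fun u : X → BWord Z => evalAlg (freeP k Z) (fun i => of k (BWord Z) (u i)) φ

/-- The operated ideal of `(A, P)` generated by `S`: the smallest two-sided ideal which contains `S`
and is closed under `P`. -/
def opIdeal {A : Type*} [Ring A] [Algebra k A] (P : A →ₗ[k] A) (S : Set A) : TwoSidedIdeal A :=
  sInf {J : TwoSidedIdeal A | S ⊆ J ∧ ∀ a ∈ J, P a ∈ J}

theorem map_mem_opIdeal {A : Type*} [Ring A] [Algebra k A] (P : A →ₗ[k] A) (S : Set A) {a : A}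
    (ha : a ∈ opIdeal P S) : P a ∈ opIdeal P S := by
  rw [opIdeal, TwoSidedIdeal.mem_sInf] at ha ⊢
  exact fun J hJ => hJ.2 a (ha J hJ)

/-- The operator which `P` induces on the quotient of `A` by the operated ideal generated
by `S`. -/
def quotP {A : Type*} [Ring A] [Algebra k A] (P : A →ₗ[k] A) (S : Set A) :
    (opIdeal P S).ringCon.Quotient →ₗ[k] (opIdeal P S).ringCon.Quotient where
  toFun := Quotient.map' P fun a b h => by
    change (opIdeal P S).ringCon a b at h
    change (opIdeal P S).ringCon (P a) (P b)
    rw [TwoSidedIdeal.rel_iff] at h ⊢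
    rw [← map_sub]
    exact map_mem_opIdeal P S h
  map_add' x y := by
    induction x using Quotient.inductionOn' with | _ a
    induction y using Quotient.inductionOn' with | _ b
    exact congrArg Quotient.mk'' (map_add P a b)
  map_smul' c x := by
    induction x using Quotient.inductionOn' with | _ a
    exact congrArg Quotient.mk'' (map_smul P c a)

/-- `(F, PF)`, together with the homomorphism of unital algebras `i : A → F`, is the free
`φ`-algebra over the unital algebra `A`. -/
def IsFreePhiAlgebraOver.{w, v, x, a, f} {k : Type v} [Field k] {X : Type x} {A : Type a}
    {F : Type f} [Ring A] [Algebra k A] [Ring F] [Algebra k F]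
    (φ : MonoidAlgebra k (BWord X)) (PF : F →ₗ[k] F) (i : A →ₐ[k] F) : Prop :=
  IsPhiAlgebra φ PF ∧
    ∀ (B : Type w) [Ring B] [Algebra k B] (PB : B →ₗ[k] B), IsPhiAlgebra φ PB →
      ∀ g : A →ₐ[k] B, ∃! h : F →ₐ[k] B, (∀ b, h (PF b) = PB (h b)) ∧ h.comp i = g

end Algebras

/-! ### Leading monomials, compositions and Gröbner–Shirshov bases

The notions below are common to `k𝓜(Z)` and `k𝔐(Z)`.  The parameters are the monoid `M` of
monomials, the set `C` of contexts with the substitution `app q u = q|_u`, the breadth `len` and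
the strict order `r`. -/

section GS

variable {k : Type*} [Field k] {M C : Type*} [Monoid M]

/-- `r` is (the strict part of) a monomial order: a well-order with `u < v → q|_u < q|_v`. -/
def IsMonomialOrder (app : C → M → M) (r : M → M → Prop) : Prop :=
  IsWellOrder M r ∧ ∀ q u v, r u v → r (app q u) (app q v)

open Classical in
/-- The leading monomial of `f`: the largest monomial of `f`; by convention it is `1` for
`f = 0`. -/
noncomputable def lead (r : M → M → Prop) (f : MonoidAlgebra k M) : M :=
  if h : ∃ m ∈ f.coeff.support, ∀ m' ∈ f.coeff.support, m' ≠ m → r m' m then h.choose else 1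

/-- The monic multiple of `f ≠ 0`. -/
noncomputable def monic (r : M → M → Prop) (f : MonoidAlgebra k M) : MonoidAlgebra k M :=
  (f.coeff (lead r f))⁻¹ • f

/-- The element `q|_f = ∑ᵢ cᵢ q|_{uᵢ}` for `f = ∑ᵢ cᵢ uᵢ`. -/
noncomputable def appLin (app : C → M → M) (q : C) :
    MonoidAlgebra k M →ₗ[k] MonoidAlgebra k M :=
  MonoidAlgebra.mapDomainLinearMap k k (app q)

/-- `f` is trivial modulo `(S, w)`: it is a linear combination of elements `q|_s` with `s ∈ S`
and `q|_{s̄} < w`. -/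
def IsTrivialMod (app : C → M → M) (r : M → M → Prop) (S : Set (MonoidAlgebra k M)) (w : M)
    (f : MonoidAlgebra k M) : Prop :=
  f ∈ Submodule.span k {p | ∃ q, ∃ s ∈ S, r (app q (lead r s)) w ∧ p = appLin app q s}

/-- `S` is a Gröbner–Shirshov basis: all intersection compositions `f u - v g` and all inclusion
compositions `f - q|_g` of monicized elements of `S` are trivial modulo `(S, w)`. -/
def IsGSBasis (app : C → M → M) (len : M → ℕ) (r : M → M → Prop)
    (S : Set (MonoidAlgebra k M)) : Prop :=
  ∀ f ∈ S, ∀ g ∈ S, f ≠ 0 → g ≠ 0 →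
    (∀ w u v : M, w = lead r f * u → w = v * lead r g →
      max (len (lead r f)) (len (lead r g)) < len w →
      len w < len (lead r f) + len (lead r g) →
      IsTrivialMod app r S w (monic r f * of k M u - of k M v * monic r g)) ∧
    (∀ (w : M) (q : C), w = lead r f → w = app q (lead r g) →
      IsTrivialMod app r S w (monic r f - appLin app q (monic r g)))

end GS

/-- `G` is a Gröbner–Shirshov basis of the ideal `I` of `k𝓜(Z)` with respect to `r`. -/
def IsGSBasisOf {k : Type*} [Field k] {Z : Type*} (r : FreeMonoid Z → FreeMonoid Z → Prop)
    (G : Set (MonoidAlgebra k (FreeMonoid Z)))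
    (I : TwoSidedIdeal (MonoidAlgebra k (FreeMonoid Z))) : Prop :=
  IsGSBasis freeApp FreeMonoid.length r G ∧ TwoSidedIdeal.span G = I

/-- `S` is an operated Gröbner–Shirshov basis of the operated ideal `J` of `k𝔐(Z)` with respect
to `r`. -/
def IsOperatedGSBasisOf {k : Type*} [Field k] {Z : Type*} (r : BWord Z → BWord Z → Prop)
    (S : Set (MonoidAlgebra k (BWord Z))) (J : TwoSidedIdeal (MonoidAlgebra k (BWord Z))) : Prop :=
  IsGSBasis Ctx.app breadth r S ∧ opIdeal (freeP k Z) S = J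

/-! ### The orders -/

/-- The (strict) degree lexicographical order on `𝓜(Z)`. -/
def dlexLt {Z : Type*} [LinearOrder Z] (u v : FreeMonoid Z) : Prop :=
  u.length < v.length ∨ (u.length = v.length ∧ List.Lex (· < ·) u.toList v.toList)

/-- The (strict) order `<_db` on `𝔐(Z)`.  Words are compared first by the number of operators, then
by the number `r` in the factorisation `u = u₀ ⌊u₁*⌋ u₁ ⋯ ⌊uᵣ*⌋ uᵣ`, and then by comparing
the tuples `(u₁*, …, uᵣ*, u₀, …, uᵣ)` lexicographically, where the `uᵢ*` are compared recursively
and the `uᵢ` by the degree lexicographical order. -/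
inductive DbLt {Z : Type*} [LinearOrder Z] : BWord Z → BWord Z → Prop
  | deg {u v : BWord Z} : degP u < degP v → DbLt u v
  | breadth {u v : BWord Z} : degP u = degP v → breadthP u < breadthP v → DbLt u v
  | inner {u v : BWord Z} (l l₁ l₂ : List (BWord Z)) (a b : BWord Z) :
      degP u = degP v → breadthP u = breadthP v →
      u.inner = l ++ a :: l₁ → v.inner = l ++ b :: l₂ → DbLt a b → DbLt u v
  | outer {u v : BWord Z} : degP u = degP v → breadthP u = breadthP v →
      u.inner = v.inner → List.Lex dlexLt u.outer v.outer → DbLt u v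

/-! ### Operated polynomial identities of Rota–Baxter type

The variables `x` and `y` are the letters `0` and `1` of `Fin 2`. -/

section RotaBaxter

variable {k : Type*} [Field k]

/-- The monomial `⌊u⌋⌊v⌋`. -/
def brbr {Z : Type*} (u v : BWord Z) : BWord Z := br u * br v

/-- The element `B(a, b)` of `k𝔐(Z)`, for `a, b ∈ k𝔐(Z)`. -/
noncomputable def eval₂ {Z : Type*} (B : MonoidAlgebra k (BWord (Fin 2)))
    (a b : MonoidAlgebra k (BWord Z)) : MonoidAlgebra k (BWord Z) :=
  evalAlg (freeP k Z) ![a, b] B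

/-- One-step rewriting on `k𝔐(Z)` by the rules `q|_{⌊u⌋⌊v⌋} → q|_{⌊B(u, v)⌋}`: a monomial
`t = q|_{⌊u⌋⌊v⌋}` which occurs in `f` with coefficient `c ≠ 0` is replaced. -/
def RewriteStep {Z : Type*} (B : MonoidAlgebra k (BWord (Fin 2)))
    (f g : MonoidAlgebra k (BWord Z)) : Prop :=
  ∃ (q : Ctx Z) (u v : BWord Z), f.coeff (q.app (brbr u v)) ≠ 0 ∧
    g = f - f.coeff (q.app (brbr u v)) • of k _ (q.app (brbr u v)) +
      f.coeff (q.app (brbr u v)) •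
        appLin Ctx.app q (freeP k Z (eval₂ B (of k _ u) (of k _ v)))

/-- `φ = ⌊x⌋⌊y⌋ - ⌊B(x, y)⌋` is an operated polynomial identity of Rota–Baxter type. -/
def IsRotaBaxterType.{u, v} {k : Type v} [Field k] (φ : MonoidAlgebra k (BWord (Fin 2))) : Prop :=
  ∃ B : MonoidAlgebra k (BWord (Fin 2)),
    φ = of k _ (brbr (var 0) (var 1)) - freeP k (Fin 2) B ∧
    (∀ m ∈ B.coeff.support, ∀ i, count i m = 1) ∧
    (∀ m ∈ B.coeff.support, ∀ (q : Ctx (Fin 2)) (a b : BWord (Fin 2)),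
      a ≠ 1 → b ≠ 1 → m ≠ q.app (brbr a b)) ∧
    (∀ Z : Type u, ¬ ∃ s : ℕ → MonoidAlgebra k (BWord Z), ∀ n, RewriteStep B (s n) (s (n + 1))) ∧
    (∀ (Z : Type u) (a b c : BWord Z), a ≠ 1 → b ≠ 1 → c ≠ 1 →
      Relation.ReflTransGen (RewriteStep B)
        (eval₂ B (eval₂ B (of k _ a) (of k _ b)) (of k _ c) -
          eval₂ B (of k _ a) (eval₂ B (of k _ b) (of k _ c))) 0)

end RotaBaxter

end OperatedGS

open OperatedGS

universe u v w

namespace OperatedGS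

/-! ### Lexicographic comparison of lists -/

/-! The free algebra. Every monomial of `φ` contains `x` and `y` exactly once, so `φ(a, b)` is
bilinear, and imposing it on pairs of bracketed words imposes it on the whole quotient. A
homomorphism `g` on `A` prescribes the values of the letters. The induced operated morphism on
`k𝔐(Z)` agrees with `g` on `k𝓜(Z)`, hence kills `I_A`, and it kills `S_φ(Z)` because its target is a
`φ`-algebra.

The order. `dbLt_iff` turns `DbLt` into three comparisons: degree, shortlex on the contents of the
brackets, shortlex on the letter blocks. The content of a bracket has smaller degree than the word,
so well-foundedness and trichotomy follow by induction on the degree.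

The basis. If every `⌊b(u,v)⌋` lies below `⌊u⌋⌊v⌋` (`IsReducing`), then `⌊u⌋⌊v⌋` is the leading
monomial of `φ(u,v)`. Two such words overlap in one bracket, and `φ(u,v)⌊w⌋ - ⌊u⌋φ(v,w) =
φ(u,B(v,w)) - φ(B(u,v),w) - ⌊B(B(u,v),w) - B(u,B(v,w))⌋`. The first two terms are trivial by
linearity. The last is trivial because each rewriting step subtracts a multiple of some
`q|_{φ(a,b)}` with leading monomial below `⌊u⌋⌊v⌋⌊w⌋` (`overlap_mem`). The rewriting hypothesis
excludes empty words while `u, v, w` may be empty, so it is used for three distinct letters and then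
specialised. If a leading monomial sits inside `u` or `v`, linearity of `φ` resolves the composition
(`nested_mem`). Leading monomials from `G` contain no bracket, so they have no overlap with
`⌊u⌋⌊v⌋`, and the compositions within `G` are those of `k𝓜(Z)`. For `DbLt` the leading monomial of
`φ` alone decides, since a substitution raises the degree of all monomials of `φ` equally
(`dbLt_eval_of_lead_eq`). -/

theorem lex_exists_of_length_eq {α : Type*} {r : α → α → Prop} {s t : List α}
    (h : List.Lex r s t) (hl : s.length = t.length) :
    ∃ l s' t' a b, s = l ++ a :: s' ∧ t = l ++ b :: t' ∧ r a b := by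
  induction h with
  | nil => simp at hl
  | @cons a s t _ ih =>
    obtain ⟨l, s', t', x, y, rfl, rfl, hxy⟩ := ih (by simpa using hl)
    exact ⟨a :: l, s', t', x, y, rfl, rfl, hxy⟩
  | @rel a s b t hab => exact ⟨[], s, t, a, b, rfl, rfl, hab⟩

/-- Plain lexicographic order fails here when `s` is a proper prefix of `t`; shortlex settles that
case by length. -/
theorem shortlex_append_right {α : Type*} {r : α → α → Prop} {s t : List α}
    (h : List.Shortlex r s t) (m : List α) : List.Shortlex r (s ++ m) (t ++ m) := by
  rcases List.shortlex_def.mp h with h | ⟨hl, h⟩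
  · exact .of_length_lt (by simpa using h)
  · obtain ⟨l, s', t', a, b, rfl, rfl, hab⟩ := lex_exists_of_length_eq h hl
    refine .of_lex (by simpa using hl) ?_
    simpa using List.Lex.append_left r (.rel hab) l

theorem shortlex_map_head {α : Type*} {r : α → α → Prop} {f : α → α}
    (hf : ∀ a b, r a b → r (f a) (f b)) {x y : α} {s t : List α}
    (h : List.Shortlex r (x :: s) (y :: t)) : List.Shortlex r (f x :: s) (f y :: t) := by
  rcases List.shortlex_def.mp h with h | ⟨hl, h⟩
  · exact .of_length_lt (by simpa using h)
  · refine .of_lex (by simpa using hl) ?_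
    cases h with
    | cons h => exact .cons h
    | rel h => exact .rel (hf _ _ h)

/-- Models right multiplication by a word: its first letter block fuses with the last block of each
factor (`f`), and its other blocks `m` are appended. -/
theorem shortlex_map_last {α : Type*} {r : α → α → Prop} {f : α → α}
    (hf : ∀ a b, r a b → r (f a) (f b)) {x y : α} {s t : List α} (m : List α)
    (h : List.Shortlex r (s ++ [x]) (t ++ [y])) :
    List.Shortlex r (s ++ f x :: m) (t ++ f y :: m) := by
  rcases List.shortlex_def.mp h with h | ⟨hl, h⟩
  · exact .of_length_lt (by simp at h ⊢; omega)
  · refine .of_lex (by simp at hl ⊢; omega) ?_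
    have hl : s.length = t.length := by simpa using hl
    clear * - hf h hl
    induction s generalizing t with
    | nil =>
      obtain rfl : t = [] := by simpa [eq_comm] using hl
      simpa using! List.Lex.rel (hf _ _ (by simpa using h))
    | cons a s ih =>
      cases t with
      | nil => simp at hl
      | cons b t =>
        cases h with
        | cons h => exact .cons (ih h (by simpa using hl))
        | rel h => exact .rel h

/-! ### The factorisation of a bracketed word -/

namespace BWord

variable {Z : Type*}

theorem inner_mul (a b : BWord Z) : inner (a * b) = inner a ++ inner b := by
  induction a with
  | one => rfl
  | letter z w ih => exact ih
  | bracket c w _ ih => exact congrArg (c :: ·) ih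

theorem degP_mul (a b : BWord Z) : degP (a * b) = degP a + degP b := by
  induction a with
  | one => exact (zero_add _).symm
  | letter z w ih => exact ih
  | bracket c w _ ih => simp only [bracket_mul, degP, ih]; omega

theorem degP_br (a : BWord Z) : degP (br a) = degP a + 1 := Nat.add_comm 1 (degP a)

theorem inner_br (a : BWord Z) : inner (br a) = [a] := rfl

theorem breadth_br (a : BWord Z) : breadth (br a) = 1 := rfl

theorem breadth_mul (a b : BWord Z) : breadth (a * b) = breadth a + breadth b := by
  induction a with
  | one => exact (zero_add _).symm
  | letter z w ih => simp only [letter_mul, breadth, ih]; omega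
  | bracket c w _ ih => simp only [bracket_mul, breadth, ih]; omega

theorem length_outer (a : BWord Z) : (outer a).length = (inner a).length + 1 := by
  induction a with
  | one => rfl
  | letter z w ih => simpa [outer, inner] using ih
  | bracket c w _ ih => simpa [outer, inner] using ih

theorem exists_outer_eq_cons (a : BWord Z) : ∃ x l, outer a = x :: l :=
  List.exists_cons_of_length_eq_add_one (length_outer a)

theorem exists_outer_eq_concat (a : BWord Z) : ∃ l x, outer a = l ++ [x] :=
  (List.eq_nil_or_concat' (outer a)).resolve_left
    (List.ne_nil_of_length_eq_add_one (length_outer a))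

theorem outer_mul {a b : BWord Z} {l m : List (FreeMonoid Z)} {x y : FreeMonoid Z}
    (ha : outer a = l ++ [x]) (hb : outer b = y :: m) : outer (a * b) = l ++ (x * y) :: m := by
  induction a generalizing l x with
  | one =>
    cases l with
    | nil =>
      obtain rfl : 1 = x := by simpa [outer] using ha
      simpa using! hb
    | cons => simp [outer] at ha
  | letter z w ih =>
    obtain ⟨l', x', hw⟩ := exists_outer_eq_concat w
    simp only [letter_mul, outer, ih hw]
    simp only [outer, hw] at ha
    cases l' with
    | nil =>
      cases l with
      | nil =>
        obtain rfl : FreeMonoid.of z * x' = x := by simpa using ha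
        simp [mul_assoc]
      | cons => simp at ha
    | cons p l' =>
      cases l with
      | nil => simp at ha
      | cons p' l =>
        simp only [List.cons_append, List.modifyHead_cons, List.cons.injEq] at ha ⊢
        obtain ⟨h1, h2⟩ := ha
        obtain ⟨rfl, h3⟩ := List.append_inj' h2 rfl
        simp_all
  | bracket c w _ ih =>
    cases l with
    | nil => simp [outer, ← List.length_eq_zero_iff, length_outer] at ha
    | cons p l =>
      simp only [outer, List.cons_append, List.cons.injEq] at ha
      simp [bracket_mul, outer, ih ha.2, ha.1]

theorem eq_of_inner_outer {a b : BWord Z} (hi : inner a = inner b) (ho : outer a = outer b) :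
    a = b := by
  -- A word that begins with a letter has a nonempty first block, which tells it apart from the
  -- empty word and from words that begin with a bracket.
  have key : ∀ (z : Z) (w : BWord Z) (l : List (FreeMonoid Z)), outer (letter z w) ≠ 1 :: l := by
    intro z w l h
    obtain ⟨x, m, hx⟩ := exists_outer_eq_cons w
    simp only [outer, hx, List.modifyHead_cons, List.cons.injEq] at h
    simpa using congrArg FreeMonoid.length h.1
  induction a generalizing b with
  | one =>
    cases b with
    | one => rfl
    | letter z w => exact absurd ho.symm (key z w _)
    | bracket c w => simp [inner] at hi
  | letter z w ih =>
    cases b with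
    | one => exact absurd ho (key z w _)
    | letter z' w' =>
      obtain ⟨x, l, hx⟩ := exists_outer_eq_cons w
      obtain ⟨x', l', hx'⟩ := exists_outer_eq_cons w'
      simp only [outer, hx, hx', List.modifyHead_cons, List.cons.injEq] at ho
      have h := congrArg FreeMonoid.toList ho.1
      simp only [FreeMonoid.toList_of_mul, List.cons.injEq] at h
      obtain rfl := h.1
      exact congrArg _ (ih hi (by rw [hx, hx', ho.2, FreeMonoid.toList.injective h.2]))
    | bracket c w' => exact absurd ho (key z w _)
  | bracket c w _ ih =>
    cases b with
    | one => simp [inner] at hi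
    | letter z' w' => exact absurd ho.symm (key z' w' _)
    | bracket c' w' =>
      simp only [inner, outer, List.cons.injEq, true_and] at hi ho
      rw [hi.1, ih hi.2 ho]

theorem degP_lt_of_mem_inner {a b : BWord Z} (h : a ∈ inner b) : degP a < degP b := by
  induction b with
  | one => simp [inner] at h
  | letter z w ih => exact ih h
  | bracket c w _ ih =>
    simp only [inner, List.mem_cons] at h
    rcases h with rfl | h
    · simp only [degP]; omega
    · have := ih h
      simp only [degP]; omega

theorem ofFree_of_mul (z : Z) (h : FreeMonoid Z) :
    ofFree Z (FreeMonoid.of z * h) = letter z (ofFree Z h) := by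
  simp [ofFree, var, letter_mul]

theorem inner_ofFree (h : FreeMonoid Z) : inner (ofFree Z h) = [] := by
  induction h using FreeMonoid.inductionOn' with
  | one => rfl
  | of_mul z h ih => rw [ofFree_of_mul]; exact ih

theorem outer_ofFree (h : FreeMonoid Z) : outer (ofFree Z h) = [h] := by
  induction h using FreeMonoid.inductionOn' with
  | one => rfl
  | of_mul z h ih => rw [ofFree_of_mul, outer, ih]; rfl

theorem degP_ofFree (h : FreeMonoid Z) : degP (ofFree Z h) = 0 := by
  induction h using FreeMonoid.inductionOn' with
  | one => rfl
  | of_mul z h ih => rw [ofFree_of_mul]; exact ih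

theorem breadth_ofFree (h : FreeMonoid Z) : breadth (ofFree Z h) = h.length := by
  induction h using FreeMonoid.inductionOn' with
  | one => rfl
  | of_mul z h ih => simp [ofFree_of_mul, breadth, ih]

theorem ofFree_injective : Function.Injective (ofFree Z) := fun a b h => by
  simpa [outer_ofFree] using congrArg outer h

theorem exists_ofFree_eq {a : BWord Z} (h : degP a = 0) : ∃ b, ofFree Z b = a := by
  induction a with
  | one => exact ⟨1, rfl⟩
  | letter z w ih =>
    obtain ⟨b, rfl⟩ := ih h
    exact ⟨_, ofFree_of_mul z b⟩
  | bracket c w => simp only [degP] at h; omega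

theorem breadth_eq_zero {a : BWord Z} (h : breadth a = 0) : a = 1 := by
  cases a with
  | one => rfl
  | letter z w => simp only [breadth] at h; omega
  | bracket c w => simp only [breadth] at h; omega

end BWord

open BWord

/-! ### The order `<_db` -/

section Orders

variable {Z : Type*} [LinearOrder Z]

theorem dlexLt_iff {a b : FreeMonoid Z} :
    dlexLt a b ↔ List.Shortlex (· < ·) a.toList b.toList :=
  List.shortlex_def.symm

theorem dlexLt.mul_left {a b : FreeMonoid Z} (h : dlexLt a b) (c : FreeMonoid Z) :
    dlexLt (c * a) (c * b) :=
  dlexLt_iff.2 ((dlexLt_iff.1 h).append_left c.toList)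

theorem dlexLt.mul_right {a b : FreeMonoid Z} (h : dlexLt a b) (c : FreeMonoid Z) :
    dlexLt (a * c) (b * c) :=
  dlexLt_iff.2 (shortlex_append_right (dlexLt_iff.1 h) c.toList)

theorem dlexLt_wellFounded [WellFoundedLT Z] : WellFounded (dlexLt (Z := Z)) := by
  have h : (dlexLt (Z := Z)) = InvImage (List.Shortlex (· < ·)) FreeMonoid.toList := by
    ext a b; exact dlexLt_iff
  rw [h]
  exact InvImage.wf _ (List.Shortlex.wf wellFounded_lt)

instance : Std.Trichotomous (dlexLt (Z := Z)) where
  trichotomous _ _ h1 h2 := FreeMonoid.toList.injective <|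
    Std.Trichotomous.trichotomous (r := List.Shortlex (· < ·)) _ _
      (fun h => h1 (dlexLt_iff.2 h)) (fun h => h2 (dlexLt_iff.2 h))

/-- Shortlex on `inner` absorbs the comparison of `r`; on `outer` it agrees with `List.Lex`, as
equal `inner` lists force equal lengths. Unlike `List.Lex`, shortlex inherits well-foundedness. -/
theorem dbLt_iff {a b : BWord Z} :
    DbLt a b ↔ degP a < degP b ∨ (degP a = degP b ∧
      (List.Shortlex DbLt a.inner b.inner ∨
        (a.inner = b.inner ∧ List.Shortlex dlexLt a.outer b.outer))) := by
  constructor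
  · intro h
    cases h with
    | deg h => exact .inl h
    | breadth h h' => exact .inr ⟨h, .inl (.of_length_lt h')⟩
    | inner l l₁ l₂ c d h h' ha hb hcd =>
      refine .inr ⟨h, .inl (.of_lex h' ?_)⟩
      rw [ha, hb]
      exact List.Lex.append_left _ (.rel hcd) l
    | outer h h' hi ho =>
      exact .inr ⟨h, .inr ⟨hi, .of_lex (by rw [length_outer, length_outer, hi]) ho⟩⟩
  · rintro (h | ⟨h, h' | ⟨hi, ho⟩⟩)
    · exact .deg h
    · rcases List.shortlex_def.mp h' with h' | ⟨hl, h'⟩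
      · exact .breadth h h'
      · obtain ⟨l, s, t, c, d, ha, hb, hcd⟩ := lex_exists_of_length_eq h' hl
        exact .inner l s t c d h hl ha hb hcd
    · refine .outer h (congrArg List.length hi) hi ?_
      rwa [List.shortlex_iff_lex (by rw [length_outer, length_outer, hi])] at ho

theorem DbLt.mul_left {a b : BWord Z} (h : DbLt a b) (c : BWord Z) : DbLt (c * a) (c * b) := by
  rw [dbLt_iff] at h ⊢
  simp only [degP_mul, inner_mul, add_lt_add_iff_left, add_right_inj]
  refine h.imp_right (And.imp_right (Or.imp (·.append_left _) (And.imp (by rw [·]) fun ho => ?_)))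
  obtain ⟨l, x, hc⟩ := exists_outer_eq_concat c
  obtain ⟨y, m, ha⟩ := exists_outer_eq_cons a
  obtain ⟨y', m', hb⟩ := exists_outer_eq_cons b
  -- Only the block at the seam changes, by left multiplication with the last block `x` of `c`.
  rw [outer_mul hc ha, outer_mul hc hb]
  rw [ha, hb] at ho
  exact (shortlex_map_head (fun _ _ h => h.mul_left x) ho).append_left l

theorem DbLt.mul_right {a b : BWord Z} (h : DbLt a b) (c : BWord Z) : DbLt (a * c) (b * c) := by
  rw [dbLt_iff] at h ⊢
  simp only [degP_mul, inner_mul, add_lt_add_iff_right, add_left_inj]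
  refine h.imp_right (And.imp_right (Or.imp (shortlex_append_right · _)
    (And.imp (by rw [·]) fun ho => ?_)))
  obtain ⟨y, m, hc⟩ := exists_outer_eq_cons c
  obtain ⟨l, x, ha⟩ := exists_outer_eq_concat a
  obtain ⟨l', x', hb⟩ := exists_outer_eq_concat b
  rw [outer_mul ha hc, outer_mul hb hc]
  rw [ha, hb] at ho
  exact shortlex_map_last (fun _ _ h => h.mul_right y) m ho

theorem DbLt.br {a b : BWord Z} (h : DbLt a b) : DbLt (br a) (br b) := by
  have h' := dbLt_iff.1 h
  refine dbLt_iff.2 ?_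
  simp only [degP_br, inner_br, List.shortlex_singleton_iff, h, true_or, and_true]
  omega

theorem DbLt.app {a b : BWord Z} (h : DbLt a b) (q : Ctx Z) : DbLt (q.app a) (q.app b) := by
  induction q with
  | hole c d => exact (h.mul_left c).mul_right d
  | nest c q d ih => exact (ih.br.mul_left c).mul_right d

theorem dbLt_trichotomous (a b : BWord Z) (h1 : ¬ DbLt a b) (h2 : ¬ DbLt b a) : a = b := by
  induction hn : degP a using Nat.strong_induction_on generalizing a b with
  | _ n ih =>
  rw [dbLt_iff] at h1 h2
  push Not at h1 h2
  have hd : degP a = degP b := by omega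
  obtain ⟨h1, h1'⟩ := h1.2 hd
  obtain ⟨h2, h2'⟩ := h2.2 hd.symm
  have hi : a.inner = b.inner := by
    have hl : a.inner.length = b.inner.length := by
      rw [List.shortlex_def] at h1 h2
      push Not at h1 h2
      omega
    -- At the first place where the lists differ the entries have smaller degree, so the induction
    -- hypothesis compares them.
    by_contra hne
    obtain ⟨l, s, t, x, y, ha, hb, hxy⟩ :=
      lex_exists_of_length_eq ((List.Lex.ne_iff hl.le).2 hne) hl
    have hx : degP x < n := hn ▸ degP_lt_of_mem_inner (by rw [ha]; simp)
    refine hxy (ih _ hx x y (fun h => h1 ?_) (fun h => h2 ?_) rfl)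
    · exact .of_lex hl (by rw [ha, hb]; exact List.Lex.append_left _ (.rel h) l)
    · exact .of_lex hl.symm (by rw [ha, hb]; exact List.Lex.append_left _ (.rel h) l)
  exact eq_of_inner_outer hi
    (Std.Trichotomous.trichotomous (r := List.Shortlex dlexLt) _ _ (h1' hi) (h2' hi.symm))

theorem dbLt_wellFounded [WellFoundedLT Z] : WellFounded (DbLt (Z := Z)) := by
  suffices H : ∀ n, ∀ a : BWord Z, degP a = n → Acc DbLt a from ⟨fun a => H _ a rfl⟩
  intro n
  induction n using Nat.strong_induction_on with
  | _ n ih =>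
  -- Cutting `DbLt` down to predecessors of degree below `n` makes it well-founded by induction.
  -- This suffices for shortlex on `inner`, whose entries have degree below `n`.
  let r : BWord Z → BWord Z → Prop := fun a b => DbLt a b ∧ degP a < n
  have hr : WellFounded r := by
    refine ⟨fun b => ⟨b, fun a ha => ?_⟩⟩
    exact Subrelation.accessible (fun h => h.1) (ih _ ha.2 a rfl)
  have hR : WellFounded (Prod.Lex (List.Shortlex r) (List.Shortlex (dlexLt (Z := Z)))) :=
    WellFounded.prod_lex (List.Shortlex.wf hr) (List.Shortlex.wf dlexLt_wellFounded)
  suffices H : ∀ p, ∀ a : BWord Z, degP a = n → (inner a, outer a) = p → Acc DbLt a from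
    fun a ha => H _ a ha rfl
  intro p
  induction p using hR.induction with
  | _ p ihp =>
  rintro a ha rfl
  refine ⟨a, fun b hb => ?_⟩
  rcases dbLt_iff.1 hb with h | ⟨h, h' | ⟨hi, ho⟩⟩
  · exact ih _ (ha ▸ h) b rfl
  · refine ihp _ (Prod.Lex.left _ _ ?_) b (h.trans ha) rfl
    rcases List.shortlex_def.mp h' with h' | ⟨hl, h'⟩
    · exact .of_length_lt h'
    · obtain ⟨l, s, t, x, y, hb, ha', hxy⟩ := lex_exists_of_length_eq h' hl
      have hx : degP x < n := ha ▸ h ▸ degP_lt_of_mem_inner (by rw [hb]; simp)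
      exact .of_lex hl (by rw [ha', hb]; exact List.Lex.append_left _ (.rel ⟨hxy, hx⟩) l)
  · refine ihp _ ?_ b (h.trans ha) rfl
    rw [hi]
    exact Prod.Lex.right _ ho

theorem isMonomialOrder_dbLt [WellFoundedLT Z] :
    IsMonomialOrder Ctx.app (DbLt (Z := Z)) :=
  ⟨{ wf := dbLt_wellFounded, trichotomous := dbLt_trichotomous }, fun q _ _ h => h.app q⟩

theorem dbLt_ofFree_iff (a b : FreeMonoid Z) :
    DbLt (BWord.ofFree Z a) (BWord.ofFree Z b) ↔ dlexLt a b := by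
  simp [dbLt_iff, degP_ofFree, inner_ofFree, outer_ofFree]

end Orders

/-! ### Evaluation of bracketed words -/

namespace BWord

variable {X Z M : Type*} [Monoid M]

theorem eval_var (P : M → M) (θ : X → M) (i : X) : eval P θ (var i) = θ i := mul_one _

theorem eval_br (P : M → M) (θ : X → M) (a : BWord X) : eval P θ (br a) = P (eval P θ a) :=
  mul_one _

theorem map_eval {N : Type*} [Monoid N] {P : M → M} {Q : N → N} (h : M →* N)
    (hP : ∀ a, h (P a) = Q (h a)) (θ : X → M) (m : BWord X) :
    h (eval P θ m) = eval Q (h ∘ θ) m := by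
  induction m with
  | one => exact map_one h
  | letter z w ih => simp only [eval, map_mul, ih, Function.comp]
  | bracket c w ihc ih => simp only [eval, map_mul, ih, hP, ihc]

variable [DecidableEq X]

theorem eval_update_of_count_eq_zero {i : X} {m : BWord X} (hm : count i m = 0) (P : M → M)
    (θ : X → M) (a : M) : eval P (Function.update θ i a) m = eval P θ m := by
  induction m with
  | one => rfl
  | letter z w ih =>
    simp only [count] at hm
    have hz : z ≠ i := fun h => by rw [if_pos h] at hm; omega
    simp only [eval, Function.update_of_ne hz, ih (by omega)]
  | bracket c w ihc ih =>
    simp only [count] at hm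
    simp only [eval, ih (by omega), ihc (by omega)]

/-- Around the single occurrence of `i`, evaluation only multiplies by fixed elements and applies
`P`, both linear. -/
theorem exists_linearMap_eval_update {k A : Type*} [Field k] [Ring A] [Algebra k A] {i : X}
    {m : BWord X} (hm : count i m = 1) (P : A →ₗ[k] A) (θ : X → A) :
    ∃ L : A →ₗ[k] A, ∀ a, eval P (Function.update θ i a) m = L a := by
  induction m with
  | one => simp [count] at hm
  | letter z w ih =>
    simp only [count] at hm
    by_cases hz : z = i
    · subst hz
      rw [if_pos rfl] at hm
      exact ⟨LinearMap.mulRight k (eval P θ w), fun a => by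
        simp [eval, eval_update_of_count_eq_zero (show count z w = 0 by omega)]⟩
    · rw [if_neg hz, zero_add] at hm
      obtain ⟨L, hL⟩ := ih hm
      exact ⟨LinearMap.mulLeft k (θ z) ∘ₗ L, fun a => by
        simp [eval, Function.update_of_ne hz, hL]⟩
  | bracket c w ihc ih =>
    simp only [count] at hm
    obtain h | h : (count i c = 1 ∧ count i w = 0) ∨ (count i c = 0 ∧ count i w = 1) := by omega
    · obtain ⟨L, hL⟩ := ihc h.1
      exact ⟨LinearMap.mulRight k (eval P θ w) ∘ₗ P ∘ₗ L, fun a => by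
        simp [eval, hL, eval_update_of_count_eq_zero h.2]⟩
    · obtain ⟨L, hL⟩ := ih h.2
      exact ⟨LinearMap.mulLeft k (P (eval P θ c)) ∘ₗ L, fun a => by
        simp [eval, hL, eval_update_of_count_eq_zero h.1]⟩

end BWord

/-- The context `a q b`. -/
def Ctx.mulBoth {Z : Type*} (a : BWord Z) (q : Ctx Z) (b : BWord Z) : Ctx Z :=
  match q with
  | .hole c d => .hole (a * c) (d * b)
  | .nest c q d => .nest (a * c) q (d * b)

theorem Ctx.app_mulBoth {Z : Type*} (a : BWord Z) (q : Ctx Z) (b u : BWord Z) :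
    (q.mulBoth a b).app u = a * q.app u * b := by
  cases q <;> simp only [Ctx.mulBoth, Ctx.app, mul_assoc]

/-- The context `q|_p`. -/
def Ctx.comp {Z : Type*} : Ctx Z → Ctx Z → Ctx Z
  | .hole a b, p => p.mulBoth a b
  | .nest a q b, p => .nest a (q.comp p) b

theorem Ctx.app_comp {Z : Type*} (q p : Ctx Z) (u : BWord Z) :
    (q.comp p).app u = q.app (p.app u) := by
  induction q with
  | hole a b => exact Ctx.app_mulBoth a p b u
  | nest a q b ih => simp only [Ctx.comp, Ctx.app, ih]

/-- The image of a context under a substitution of bracketed words for the letters. -/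
def Ctx.subst {X Z : Type*} (θ : X → BWord Z) : Ctx X → Ctx Z
  | .hole a b => .hole (eval br θ a) (eval br θ b)
  | .nest a q b => .nest (eval br θ a) (q.subst θ) (eval br θ b)

theorem Ctx.app_subst {X Z : Type*} (θ : X → BWord Z) (q : Ctx X) (u : BWord X) :
    (q.subst θ).app (eval br θ u) = eval br θ (q.app u) := by
  induction q with
  | hole a b => simp only [Ctx.subst, Ctx.app, eval_mul]
  | nest a q b ih => simp only [Ctx.subst, Ctx.app, eval_mul, eval_br, ih]

/-- The single occurrence of `i` becomes the position of `⋆`; the rest of `m` is evaluated at `θ`.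
-/
theorem exists_ctx_eval_update {X Z : Type*} [DecidableEq X] {i : X} {m : BWord X}
    (hm : count i m = 1) (θ : X → BWord Z) :
    ∃ q : Ctx Z, ∀ a, eval br (Function.update θ i a) m = q.app a := by
  induction m with
  | one => simp [count] at hm
  | letter z w ih =>
    simp only [count] at hm
    by_cases hz : z = i
    · subst hz
      rw [if_pos rfl] at hm
      exact ⟨.hole 1 (eval br θ w), fun a => by
        simp [eval, Ctx.app, eval_update_of_count_eq_zero (show count z w = 0 by omega)]⟩
    · rw [if_neg hz, zero_add] at hm
      obtain ⟨q, hq⟩ := ih hm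
      exact ⟨q.mulBoth (θ z) 1, fun a => by
        simp [eval, Function.update_of_ne hz, hq, Ctx.app_mulBoth]⟩
  | bracket c w ihc ih =>
    simp only [count] at hm
    obtain h | h : (count i c = 1 ∧ count i w = 0) ∨ (count i c = 0 ∧ count i w = 1) := by omega
    · obtain ⟨q, hq⟩ := ihc h.1
      exact ⟨.nest 1 q (eval br θ w), fun a => by
        simp [eval, hq, Ctx.app, eval_update_of_count_eq_zero h.2]⟩
    · obtain ⟨q, hq⟩ := ih h.2
      exact ⟨q.mulBoth (br (eval br θ c)) 1, fun a => by
        simp [eval, hq, Ctx.app_mulBoth, eval_update_of_count_eq_zero h.1]⟩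

/-! ### Evaluation of operated polynomials -/

section Evaluation

variable {k : Type*} [Field k]

theorem linearMap_ext_of {M V : Type*} [Monoid M] [AddCommGroup V] [Module k V]
    {f g : MonoidAlgebra k M →ₗ[k] V} (h : ∀ m, f (of k M m) = g (of k M m)) : f = g := by
  ext m
  simpa using h m

theorem appLin_of {M C : Type*} [Monoid M] (app : C → M → M) (q : C) (m : M) :
    appLin app q (of k M m) = of k M (app q m) := by
  simp [appLin]

theorem freeP_of {Z : Type*} (u : BWord Z) : freeP k Z (of k _ u) = of k _ (br u) := by
  simp [freeP]

theorem incl_of {Z : Type*} (u : FreeMonoid Z) : incl k Z (of k _ u) = of k _ (ofFree Z u) := by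
  simp [incl]

section General

variable {X A : Type*} [Ring A] [Algebra k A]

theorem evalAlg_of (P : A →ₗ[k] A) (θ : X → A) (m : BWord X) :
    evalAlg P θ (of k _ m) = eval P θ m :=
  lift_of _ _

theorem evalAlg_freeP (P : A →ₗ[k] A) (θ : X → A) (f : MonoidAlgebra k (BWord X)) :
    evalAlg P θ (freeP k X f) = P (evalAlg P θ f) := by
  suffices h : (evalAlg P θ).toLinearMap ∘ₗ freeP k X = P ∘ₗ (evalAlg P θ).toLinearMap from
    LinearMap.congr_fun h f
  refine linearMap_ext_of fun m => ?_
  simp only [LinearMap.comp_apply, AlgHom.toLinearMap_apply, freeP_of, evalAlg_of, eval_br]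

theorem map_evalAlg {A' : Type*} [Ring A'] [Algebra k A'] {P : A →ₗ[k] A} {P' : A' →ₗ[k] A'}
    (h : A →ₐ[k] A') (hP : ∀ a, h (P a) = P' (h a)) (θ : X → A)
    (f : MonoidAlgebra k (BWord X)) : h (evalAlg P θ f) = evalAlg P' (h ∘ θ) f := by
  suffices h : h.toLinearMap ∘ₗ (evalAlg P θ).toLinearMap =
      (evalAlg P' (h ∘ θ)).toLinearMap from LinearMap.congr_fun h f
  refine linearMap_ext_of fun m => ?_
  simp only [LinearMap.comp_apply, AlgHom.toLinearMap_apply, evalAlg_of]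
  exact map_eval (h : A →* A') hP θ m

theorem evalAlg_eq_sum (P : A →ₗ[k] A) (θ : X → A) (f : MonoidAlgebra k (BWord X)) :
    evalAlg P θ f = ∑ m ∈ f.coeff.support, f.coeff m • eval P θ m :=
  lift_apply _ _

/-- Every monomial of `f` contains the letter `i` exactly once. -/
def IsLinearIn [DecidableEq X] (i : X) (f : MonoidAlgebra k (BWord X)) : Prop :=
  ∀ m ∈ f.coeff.support, count i m = 1

theorem IsLinearIn.exists_linearMap [DecidableEq X] {i : X} {f : MonoidAlgebra k (BWord X)}
    (hf : IsLinearIn i f) (P : A →ₗ[k] A) (θ : X → A) :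
    ∃ L : A →ₗ[k] A, ∀ a, evalAlg P (Function.update θ i a) f = L a := by
  have : ∀ m, ∃ L : A →ₗ[k] A, m ∈ f.coeff.support →
      ∀ a, eval P (Function.update θ i a) m = L a := fun m => by
    by_cases hm : m ∈ f.coeff.support
    · obtain ⟨L, hL⟩ := exists_linearMap_eval_update (hf m hm) P θ
      exact ⟨L, fun _ => hL⟩
    · exact ⟨0, fun h => absurd h hm⟩
  choose L hL using this
  refine ⟨∑ m ∈ f.coeff.support, f.coeff m • L m, fun a => ?_⟩
  rw [evalAlg_eq_sum, LinearMap.sum_apply]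
  exact Finset.sum_congr rfl fun m hm => by rw [hL m hm a, LinearMap.smul_apply]

theorem IsLinearIn.exists_linearMap_left {f : MonoidAlgebra k (BWord (Fin 2))}
    (hf : IsLinearIn 0 f) (P : A →ₗ[k] A) (b : A) :
    ∃ L : A →ₗ[k] A, ∀ a, evalAlg P ![a, b] f = L a := by
  obtain ⟨L, hL⟩ := hf.exists_linearMap P ![0, b]
  exact ⟨L, fun a => by rw [← hL]; congr 2; funext i; fin_cases i <;> rfl⟩

theorem IsLinearIn.exists_linearMap_right {f : MonoidAlgebra k (BWord (Fin 2))}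
    (hf : IsLinearIn 1 f) (P : A →ₗ[k] A) (a : A) :
    ∃ L : A →ₗ[k] A, ∀ b, evalAlg P ![a, b] f = L b := by
  obtain ⟨L, hL⟩ := hf.exists_linearMap P ![a, 0]
  exact ⟨L, fun a => by rw [← hL]; congr 2; funext i; fin_cases i <;> rfl⟩

end General

theorem eval_of {X Z : Type*} (θ : X → BWord Z) (m : BWord X) :
    eval (freeP k Z) (fun i => of k _ (θ i)) m = of k _ (eval br θ m) :=
  (map_eval (of k (BWord Z)) (fun u => (freeP_of u).symm) θ m).symm

end Evaluation

/-! ### The free `φ`-algebra over an algebra -/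

section Free

variable {k : Type v} [Field k] {Z : Type u}

theorem subset_opIdeal {A : Type*} [Ring A] [Algebra k A] (P : A →ₗ[k] A) (S : Set A) :
    S ⊆ opIdeal P S := fun a ha => by
  rw [SetLike.mem_coe, opIdeal, TwoSidedIdeal.mem_sInf]
  exact fun J hJ => hJ.1 ha

theorem opIdeal_le {A : Type*} [Ring A] [Algebra k A] {P : A →ₗ[k] A} {S : Set A}
    {J : TwoSidedIdeal A} (hS : S ⊆ J) (hJ : ∀ a ∈ J, P a ∈ J) : opIdeal P S ≤ J :=
  sInf_le ⟨hS, hJ⟩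

theorem mkₐ_eq_zero_iff {A : Type*} [Ring A] [Algebra k A] {J : TwoSidedIdeal A} {a : A} :
    J.ringCon.mkₐ k a = 0 ↔ a ∈ J := by
  rw [TwoSidedIdeal.mem_iff]
  exact RingCon.eq _

theorem ringCon_le_ker {A B : Type*} [Ring A] [Algebra k A] [Ring B] [Algebra k B]
    {J : TwoSidedIdeal A} {f : A →ₐ[k] B} (h : ∀ a ∈ J, f a = 0) :
    J.ringCon ≤ RingCon.ker f.toRingHom := fun a b hab => by
  have := h _ ((TwoSidedIdeal.rel_iff _ _ _).1 hab)
  rw [map_sub, sub_eq_zero] at this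
  exact this

/-- Elements of the quotient lift to `k𝔐(Z)`. By linearity in each variable it is enough to evaluate
`φ` at words, where its values lie in `S` by hypothesis. -/
theorem isPhiAlgebra_quotP {φ : MonoidAlgebra k (BWord (Fin 2))} (hφ : ∀ i, IsLinearIn i φ)
    {S : Set (MonoidAlgebra k (BWord Z))} (hS : phiSet φ Z ⊆ S) :
    IsPhiAlgebra φ (quotP (freeP k Z) S) := by
  intro θ
  set π := (opIdeal (freeP k Z) S).ringCon.mkₐ k
  obtain ⟨f, rfl⟩ : ∃ f, θ = π ∘ f := by
    choose f hf using fun i => RingCon.mkₐ_surjective (α := k) _ (θ i)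
    exact ⟨f, funext fun i => (hf i).symm⟩
  rw [← map_evalAlg (P := freeP k Z) (P' := quotP (freeP k Z) S) π (fun a => rfl)]
  rw [show f = ![f 0, f 1] by ext i; fin_cases i <;> rfl]
  generalize f 0 = a
  generalize f 1 = b
  obtain ⟨L, hL⟩ := (hφ 0).exists_linearMap_left (freeP k Z) b
  suffices h : π.toLinearMap ∘ₗ L = 0 by
    rw [hL]
    exact LinearMap.congr_fun h a
  refine linearMap_ext_of fun u => ?_
  simp only [LinearMap.comp_apply, ← hL]
  obtain ⟨L', hL'⟩ := (hφ 1).exists_linearMap_right (freeP k Z) (of k _ u)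
  suffices h : π.toLinearMap ∘ₗ L' = 0 by
    rw [hL']
    exact LinearMap.congr_fun h b
  refine linearMap_ext_of fun v => ?_
  simp only [LinearMap.comp_apply, ← hL']
  refine (mkₐ_eq_zero_iff (k := k)).2 (subset_opIdeal _ _ (hS ⟨![u, v], ?_⟩))
  change evalAlg _ _ φ = _
  congr 2
  funext i
  fin_cases i <;> rfl

/-- The letters generate `k𝔐(Z)` as an operated algebra; this gives uniqueness in the universal
property. -/
theorem algHom_ext_of_operated {B : Type*} [Ring B] [Algebra k B] {PB : B →ₗ[k] B}
    {f g : MonoidAlgebra k (BWord Z) →ₐ[k] B} (hf : ∀ a, f (freeP k Z a) = PB (f a))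
    (hg : ∀ a, g (freeP k Z a) = PB (g a))
    (h : ∀ z, f (of k _ (var z)) = g (of k _ (var z))) : f = g := by
  refine AlgHom.toLinearMap_injective (linearMap_ext_of fun m => ?_)
  simp only [AlgHom.toLinearMap_apply]
  induction m with
  | one => exact (map_one f).trans (map_one g).symm
  | letter z w ih =>
    have : (letter z w : BWord Z) = var z * w := rfl
    rw [this, map_mul, map_mul, map_mul, ih, h]
  | bracket c w ihc ih =>
    have : (bracket c w : BWord Z) = br c * w := rfl
    rw [this, map_mul, map_mul, map_mul, ih, ← freeP_of, hf, hg, ihc]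

theorem exists_isFreePhiAlgebraOver {φ : MonoidAlgebra k (BWord (Fin 2))}
    (hφ : ∀ i, IsLinearIn i φ) (I : TwoSidedIdeal (MonoidAlgebra k (FreeMonoid Z))) :
    ∃ i : I.ringCon.Quotient →ₐ[k]
        (opIdeal (freeP k Z) (phiSet φ Z ∪ incl k Z '' I)).ringCon.Quotient,
      (∀ f : MonoidAlgebra k (FreeMonoid Z), i (f : I.ringCon.Quotient) = (incl k Z f :
        (opIdeal (freeP k Z) (phiSet φ Z ∪ incl k Z '' I)).ringCon.Quotient)) ∧
      IsFreePhiAlgebraOver.{w} φ (quotP (freeP k Z) (phiSet φ Z ∪ incl k Z '' I)) i := by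
  set S := phiSet φ Z ∪ incl k Z '' I
  set π := (opIdeal (freeP k Z) S).ringCon.mkₐ k
  have hi : ∀ a ∈ I, (π.comp (incl k Z)) a = 0 := fun a ha =>
    (mkₐ_eq_zero_iff (k := k)).2 (subset_opIdeal _ _ (.inr ⟨a, ha, rfl⟩))
  refine ⟨I.ringCon.liftₐ _ (ringCon_le_ker hi), fun f => rfl,
    isPhiAlgebra_quotP hφ Set.subset_union_left, ?_⟩
  intro B _ _ PB hB g
  let θ : Z → B := fun z => g (I.ringCon.mkₐ k (of k _ (FreeMonoid.of z)))
  have hP : ∀ a, evalAlg PB θ (freeP k Z a) = PB (evalAlg PB θ a) := evalAlg_freeP PB θ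
  -- Checked on letters, by freeness of `k𝓜(Z)`. It yields both the vanishing on `I` and the
  -- factorisation of `g`.
  have hincl : (evalAlg PB θ).comp (incl k Z) = g.comp (I.ringCon.mkₐ k) := by
    refine MonoidAlgebra.algHom_ext' ?_ ?_
    · refine FreeMonoid.hom_eq fun z => ?_
      change evalAlg PB θ (incl k Z (of k _ (FreeMonoid.of z))) = θ z
      rw [incl_of, evalAlg_of]
      exact eval_var _ _ _
    · exact Subsingleton.elim _ _
  have hker : ∀ a ∈ opIdeal (freeP k Z) S, evalAlg PB θ a = 0 := by
    intro a ha
    refine (TwoSidedIdeal.mem_ker (evalAlg PB θ)).1 (opIdeal_le ?_ ?_ ha)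
    · rintro _ (⟨u, rfl⟩ | ⟨b, hb, rfl⟩)
      · refine (TwoSidedIdeal.mem_ker _).2 ?_
        rw [map_evalAlg (P' := PB) _ hP]
        exact hB _
      · refine (TwoSidedIdeal.mem_ker _).2 ((AlgHom.congr_fun hincl b).trans ?_)
        exact (congrArg g ((mkₐ_eq_zero_iff (k := k)).2 hb)).trans (map_zero g)
    · intro b hb
      rw [TwoSidedIdeal.mem_ker] at hb ⊢
      rw [hP, hb, map_zero]
  refine ⟨RingCon.liftₐ _ _ (ringCon_le_ker hker), ⟨fun b => ?_, ?_⟩, fun h hh => ?_⟩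
  · obtain ⟨b, rfl⟩ := RingCon.mkₐ_surjective (α := k) _ b
    exact hP b
  · exact RingCon.Quotient.hom_extₐ hincl
  · refine RingCon.Quotient.hom_extₐ ?_
    refine algHom_ext_of_operated (PB := PB) (fun a => hh.1 (π a)) hP fun z => ?_
    have h1 := AlgHom.congr_fun hh.2 (I.ringCon.mkₐ k (of k _ (FreeMonoid.of z)))
    have h2 := AlgHom.congr_fun hincl (of k _ (FreeMonoid.of z))
    have h3 : incl k Z (of k _ (FreeMonoid.of z)) = of k _ (var z) := incl_of _
    rw [← h3]
    exact h1.trans h2.symm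

end Free

/-! ### Equations between bracketed words -/

namespace BWord

variable {Z : Type*}

/-- Levi's lemma, with a bracket counted as one factor. It locates all overlaps of leading
monomials. -/
theorem exists_mul_of_mul_eq_mul {a b c d : BWord Z} (h : a * b = c * d)
    (hl : breadth a ≤ breadth c) : ∃ e, c = a * e ∧ b = e * d := by
  induction a generalizing c with
  | one => exact ⟨c, rfl, h⟩
  | letter z w ih =>
    cases c with
    | one => simp [breadth] at hl
    | letter z' w' =>
      simp only [letter_mul, letter.injEq] at h
      obtain ⟨e, rfl, rfl⟩ := ih h.2 (by simpa [breadth] using hl)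
      exact ⟨e, by rw [h.1, letter_mul], rfl⟩
    | bracket c' w' => simp [letter_mul, bracket_mul] at h
  | bracket c w _ ih =>
    cases c with
    | one => simp [breadth] at hl
    | letter z' w' => simp [letter_mul, bracket_mul] at h
    | bracket c' w' =>
      simp only [bracket_mul, bracket.injEq] at h
      obtain ⟨e, rfl, rfl⟩ := ih h.2 (by simpa [breadth] using hl)
      exact ⟨e, by rw [h.1, bracket_mul], rfl⟩

theorem br_mul_inj {a b c d : BWord Z} (h : br a * c = br b * d) : a = b ∧ c = d := by
  have h' : bracket a c = bracket b d := h
  simpa using h'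

theorem br_injective : Function.Injective (br : BWord Z → BWord Z) := fun a b h =>
  (br_mul_inj (c := 1) (d := 1) (by rw [h])).1

theorem breadth_brbr (a b : BWord Z) : breadth (brbr a b) = 2 := rfl

theorem degP_brbr (a b : BWord Z) : degP (brbr a b) = degP a + degP b + 2 := by
  rw [brbr, degP_mul, degP_br, degP_br]; omega

theorem mul_br_mul_eq_brbr {a b c u v : BWord Z} (h : a * br c * b = brbr u v) :
    (a = 1 ∧ c = u ∧ b = br v) ∨ (a = br u ∧ c = v ∧ b = 1) := by
  have hl := congrArg breadth h
  rw [breadth_mul, breadth_mul, breadth_br, breadth_brbr] at hl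
  rw [mul_assoc] at h
  rcases Nat.eq_zero_or_pos (breadth a) with ha | ha
  · obtain rfl := breadth_eq_zero ha
    obtain ⟨rfl, rfl⟩ := br_mul_inj ((one_mul _).symm.trans h)
    exact .inl ⟨rfl, rfl, rfl⟩
  · obtain ⟨e, rfl, h'⟩ := exists_mul_of_mul_eq_mul h.symm ha
    rw [breadth_mul, breadth_br] at hl
    obtain rfl := breadth_eq_zero (show breadth e = 0 by omega)
    obtain rfl := breadth_eq_zero (show breadth b = 0 by omega)
    refine .inr ⟨mul_one _, ?_, rfl⟩
    simpa using (br_injective (by simpa using h')).symm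

theorem mul_brbr_mul_eq_brbr {a b c d u v : BWord Z} (h : a * brbr c d * b = brbr u v) :
    a = 1 ∧ b = 1 ∧ c = u ∧ d = v := by
  have hl := congrArg breadth h
  rw [breadth_mul, breadth_mul, breadth_brbr, breadth_brbr] at hl
  obtain rfl := breadth_eq_zero (show breadth a = 0 by omega)
  obtain rfl := breadth_eq_zero (show breadth b = 0 by omega)
  rw [one_mul, mul_one] at h
  obtain ⟨h1, h2⟩ := br_mul_inj h
  exact ⟨rfl, rfl, h1, br_injective h2⟩

/-- All factors of `⌊u⌋⌊v⌋` are brackets, so none of them can be a letter. -/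
theorem mul_ofFree_mul_eq_brbr {a b u v : BWord Z} {h : FreeMonoid Z}
    (hw : a * ofFree Z h * b = brbr u v) : h = 1 := by
  cases h using FreeMonoid.casesOn with
  | one => rfl
  | of_mul z h =>
    change _ = bracket u (bracket v one) at hw
    rw [ofFree_of_mul] at hw
    rcases a with _ | _ | ⟨c, _ | _ | ⟨c', _ | _ | _⟩⟩ <;>
      simp [one_eq, letter_mul, bracket_mul] at hw

/-- The bounds force breadth three, so the two words share exactly one bracket. -/
theorem brbr_mul_eq_mul_brbr {a b u v u' v' : BWord Z} (h : brbr u v * a = b * brbr u' v')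
    (h2 : 2 < breadth (brbr u v * a)) (h4 : breadth (brbr u v * a) < 4) :
    b = br u ∧ u' = v ∧ a = br v' := by
  have hl := congrArg breadth h
  simp only [breadth_mul, breadth_brbr] at h2 h4 hl
  have h' : br u * (br v * a) = b * brbr u' v' := by rw [← h, brbr, mul_assoc]
  obtain ⟨e, rfl, he⟩ := exists_mul_of_mul_eq_mul h' (show 1 ≤ _ by omega)
  rw [breadth_mul, breadth_br] at hl
  obtain rfl := breadth_eq_zero (show breadth e = 0 by omega)
  obtain ⟨h3, h5⟩ := br_mul_inj (he.trans (one_mul _))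
  exact ⟨mul_one _, h3.symm, h5⟩

/-- The bounds leave one factor for `b`, so `⌊v⌋` would be a factor of a word without brackets. -/
theorem brbr_mul_ne_mul_ofFree {a b u v : BWord Z} {h : FreeMonoid Z}
    (h2 : max 2 h.length < breadth (brbr u v * a))
    (h4 : breadth (brbr u v * a) < 2 + h.length) : brbr u v * a ≠ b * ofFree Z h := by
  intro hw
  have hl := congrArg breadth hw
  simp only [breadth_mul, breadth_brbr, breadth_ofFree, max_lt_iff] at h2 h4 hl
  have h' : br u * (br v * a) = b * ofFree Z h := by rw [← hw, brbr, mul_assoc]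
  obtain ⟨e, rfl, he⟩ := exists_mul_of_mul_eq_mul h' (show 1 ≤ _ by omega)
  rw [breadth_mul, breadth_br] at hl
  obtain rfl := breadth_eq_zero (show breadth e = 0 by omega)
  have hd := congrArg degP he
  rw [one_mul, degP_mul, degP_br, degP_ofFree] at hd
  omega

theorem ofFree_mul_ne_mul_brbr {a b u v : BWord Z} {h : FreeMonoid Z}
    (h2 : max h.length 2 < breadth (ofFree Z h * a))
    (h4 : breadth (ofFree Z h * a) < h.length + 2) : ofFree Z h * a ≠ b * brbr u v := by
  intro hw
  have hl := congrArg breadth hw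
  simp only [breadth_mul, breadth_brbr, breadth_ofFree, max_lt_iff] at h2 h4 hl
  have h' : (b * br u) * br v = ofFree Z h * a := by rw [hw, brbr, mul_assoc]
  obtain ⟨e, he, -⟩ := exists_mul_of_mul_eq_mul h' (by
    rw [breadth_mul, breadth_br, breadth_ofFree]; omega)
  have hd := congrArg degP he
  rw [degP_mul, degP_mul, degP_br, degP_ofFree] at hd
  omega

/-- Since the words overlap, `b` is a prefix of `h` and `a` a suffix of `h'`, so neither contains a
bracket. -/
theorem exists_ofFree_of_overlap {a b : BWord Z} {h h' : FreeMonoid Z}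
    (hw : ofFree Z h * a = b * ofFree Z h')
    (hl : breadth (ofFree Z h * a) < h.length + h'.length) :
    ∃ c d, a = ofFree Z c ∧ b = ofFree Z d ∧ h * c = d * h' := by
  have hl' := congrArg breadth hw
  simp only [breadth_mul, breadth_ofFree] at hl hl'
  obtain ⟨e, he, he'⟩ := exists_mul_of_mul_eq_mul hw.symm (by
    rw [breadth_ofFree]; omega)
  have hd := congrArg degP he
  have hd' := congrArg degP he'
  rw [degP_mul, degP_ofFree] at hd hd'
  obtain ⟨c, rfl⟩ := exists_ofFree_eq (show degP a = 0 by omega)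
  obtain ⟨d, rfl⟩ := exists_ofFree_eq (show degP b = 0 by omega)
  exact ⟨c, d, rfl, rfl, ofFree_injective (by simpa using hw)⟩

theorem degP_le_degP_app (q : Ctx Z) (u : BWord Z) : degP u ≤ degP (q.app u) := by
  induction q with
  | hole a b => simp only [Ctx.app, degP_mul]; omega
  | nest a q b ih => simp only [Ctx.app, degP_mul, degP_br]; omega

theorem exists_of_app_eq_ofFree {q : Ctx Z} {u : BWord Z} {h : FreeMonoid Z}
    (hq : q.app u = ofFree Z h) : ∃ a b, q = .hole (ofFree Z a) (ofFree Z b) := by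
  have hd := congrArg degP hq
  rw [degP_ofFree] at hd
  cases q with
  | hole a b =>
    simp only [Ctx.app, degP_mul] at hd
    obtain ⟨c, rfl⟩ := exists_ofFree_eq (show degP a = 0 by omega)
    obtain ⟨d, rfl⟩ := exists_ofFree_eq (show degP b = 0 by omega)
    exact ⟨c, d, rfl⟩
  | nest a q b => simp only [Ctx.app, degP_mul, degP_br] at hd; omega

theorem eval_brbr {X : Type*} (θ : X → BWord Z) (i j : X) :
    eval br θ (brbr (var i) (var j)) = brbr (θ i) (θ j) := by
  simp only [brbr, eval_mul, eval_br, eval_var]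

theorem eval_eval {X Y : Type*} (θ : Y → BWord Z) (η : X → BWord Y) (m : BWord X) :
    eval br θ (eval br η m) = eval br (fun i => eval br θ (η i)) m :=
  map_eval (evalHom br θ) (fun a => eval_br br θ a) η m

theorem degP_eval (θ : Fin 2 → BWord Z) (m : BWord (Fin 2)) :
    degP (eval br θ m) = degP m + count 0 m * degP (θ 0) + count 1 m * degP (θ 1) := by
  induction m with
  | one => simp [eval, degP, count, ← one_eq]
  | letter z w ih =>
    simp only [eval, degP_mul, ih, degP, count]
    fin_cases z <;> simp <;> ring
  | bracket c w ihc ih =>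
    simp only [eval, degP_mul, degP_br, ih, ihc, degP, count]
    ring

end BWord

/-! ### Leading monomials -/

section Lead

variable {k : Type*} [Field k] {M : Type*} [Monoid M]

/-- Reduces membership to monomials; this is how order relations between words become triviality of
polynomials. -/
theorem map_mem_of_mem_supported {V : Type*} [AddCommGroup V] [Module k V]
    {f : MonoidAlgebra k M} {s : Set M} (hf : f ∈ supported k k s) (L : MonoidAlgebra k M →ₗ[k] V)
    {N : Submodule k V} (h : ∀ m ∈ s, L (of k M m) ∈ N) : L f ∈ N := by
  rw [supported_eq_span_single] at hf
  refine (Submodule.span_le.2 ?_ : _ ≤ N.comap L) hf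
  rintro _ ⟨m, hm, rfl⟩
  exact h m hm

theorem of_mem_supported {s : Set M} {m : M} (hm : m ∈ s) : of k M m ∈ supported k k s := by
  rw [supported_eq_span_single]
  exact Submodule.subset_span ⟨m, hm, rfl⟩

theorem mem_of_mem_supported {N : Type*} {f : MonoidAlgebra k N} {s : Set N}
    (hf : f ∈ supported k k s) {m : N} (hm : f.coeff m ≠ 0) : m ∈ s :=
  hf (Finsupp.mem_support_iff.2 hm)

variable {r : M → M → Prop}

theorem lead_zero : lead r (0 : MonoidAlgebra k M) = 1 := by
  rw [lead, dif_neg]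
  simp

variable [IsWellOrder M r]

theorem lead_eq_of_forall {f : MonoidAlgebra k M} {m : M} (hm : f.coeff m ≠ 0)
    (h : ∀ m', f.coeff m' ≠ 0 → m' ≠ m → r m' m) : lead r f = m := by
  have hex : ∃ m ∈ f.coeff.support, ∀ m' ∈ f.coeff.support, m' ≠ m → r m' m :=
    ⟨m, Finsupp.mem_support_iff.2 hm, fun m' hm' => h m' (Finsupp.mem_support_iff.1 hm')⟩
  rw [lead, dif_pos hex]
  by_contra hne
  have h1 := h _ (Finsupp.mem_support_iff.1 hex.choose_spec.1) hne
  have h2 := hex.choose_spec.2 m (Finsupp.mem_support_iff.2 hm) (Ne.symm hne)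
  exact asymm_of r h1 h2

theorem lead_spec {f : MonoidAlgebra k M} (hf : f ≠ 0) :
    f.coeff (lead r f) ≠ 0 ∧ ∀ m, f.coeff m ≠ 0 → m ≠ lead r f → r m (lead r f) := by
  have hne : (f.coeff.support : Set M).Nonempty := by
    simpa [Finset.nonempty_iff_ne_empty] using hf
  -- The support is finite, so the reversed order on it is well-founded, and a minimal element for
  -- it is the leading monomial.
  have hwf : WellFounded (Function.swap fun a b : f.coeff.support => r a b) :=
    Finite.wellFounded_of_trans_of_irrefl _
  obtain ⟨m, hm⟩ := hne
  obtain ⟨⟨a, ha⟩, -, hmax⟩ := hwf.has_min Set.univ ⟨⟨m, hm⟩, trivial⟩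
  have h : ∀ m', f.coeff m' ≠ 0 → m' ≠ a → r m' a := fun m' hm' hne => by
    rcases trichotomous_of r m' a with h | h | h
    · exact h
    · exact absurd h hne
    · exact absurd h (hmax ⟨m', Finsupp.mem_support_iff.2 hm'⟩ trivial)
  have ha' := Finsupp.mem_support_iff.1 ha
  rw [lead_eq_of_forall ha' h]
  exact ⟨ha', h⟩

/-- Expresses "monic with leading monomial `w`" as a linear condition on `f - w`, which linear maps
can carry along. -/
theorem monic_sub_lead_mem {f : MonoidAlgebra k M} (hf : f ≠ 0) :
    monic r f - of k M (lead r f) ∈ supported k k {m | r m (lead r f)} := by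
  classical
  obtain ⟨h1, h2⟩ := lead_spec (r := r) hf
  rw [mem_supported']
  intro m hm
  by_cases hml : m = lead r f
  · subst hml
    simp [monic, h1]
  · have : f.coeff m = 0 := by
      by_contra h
      exact hm (h2 m h hml)
    simp [monic, this, Ne.symm hml]

theorem coeff_eq_one_of_sub_mem {f : MonoidAlgebra k M} {w : M}
    (h : f - of k M w ∈ supported k k {m | r m w}) : f.coeff w = 1 := by
  have := mem_supported'.1 h w (irrefl_of r w)
  simpa [sub_eq_zero] using this

theorem lead_eq_of_sub_mem {f : MonoidAlgebra k M} {w : M}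
    (h : f - of k M w ∈ supported k k {m | r m w}) : lead r f = w := by
  refine lead_eq_of_forall (by rw [coeff_eq_one_of_sub_mem h]; exact one_ne_zero) ?_
  intro m hm hne
  refine mem_of_mem_supported h (m := m) ?_
  simpa [Finsupp.single_apply, Ne.symm hne] using hm

theorem monic_eq_of_sub_mem {f : MonoidAlgebra k M} {w : M}
    (h : f - of k M w ∈ supported k k {m | r m w}) : monic r f = f := by
  rw [monic, lead_eq_of_sub_mem h, coeff_eq_one_of_sub_mem h, inv_one, one_smul]

end Lead

/-! ### Triviality modulo `(S, w)` -/

section Trivial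

variable {k : Type*} [Field k] {M C : Type*} [Monoid M]

/-- The space of all elements which are trivial modulo `(S, w)`. -/
noncomputable def trivialMod (app : C → M → M) (r : M → M → Prop) (S : Set (MonoidAlgebra k M))
    (w : M) : Submodule k (MonoidAlgebra k M) :=
  Submodule.span k {p | ∃ q, ∃ s ∈ S, r (app q (lead r s)) w ∧ p = appLin app q s}

variable {app : C → M → M} {r : M → M → Prop} {S : Set (MonoidAlgebra k M)} {w : M}

theorem appLin_mem_trivialMod {s : MonoidAlgebra k M} (hs : s ∈ S) {q : C}
    (h : r (app q (lead r s)) w) : appLin app q s ∈ trivialMod app r S w :=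
  Submodule.subset_span ⟨q, s, hs, h, rfl⟩

theorem appLin_monic_mem_trivialMod {s : MonoidAlgebra k M} (hs : s ∈ S) {q : C}
    (h : r (app q (lead r s)) w) : appLin app q (monic r s) ∈ trivialMod app r S w := by
  rw [monic, map_smul]
  exact Submodule.smul_mem _ _ (appLin_mem_trivialMod hs h)

theorem appLin_congr {app' : C → M → M} {q q' : C} (h : ∀ u, app q u = app' q' u) :
    (appLin app q : MonoidAlgebra k M →ₗ[k] _) = appLin app' q' :=
  linearMap_ext_of fun m => by rw [appLin_of, appLin_of, h]

theorem monic_sub_appLin_monic_mem (hr : IsMonomialOrder app r) {f g : MonoidAlgebra k M}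
    (hf : f ≠ 0) (hg : g ≠ 0) {q : C} (h : lead r f = app q (lead r g)) :
    monic r f - appLin app q (monic r g) ∈ supported k k {m | r m (lead r f)} := by
  have := hr.1
  have h1 := monic_sub_lead_mem (r := r) hf
  have h2 : appLin app q (monic r g - of k M (lead r g)) ∈ supported k k {m | r m (lead r f)} :=
    map_mem_of_mem_supported (monic_sub_lead_mem (r := r) hg) _ fun m hm => by
      rw [appLin_of]
      exact of_mem_supported (h ▸ hr.2 q _ _ hm)
  rw [map_sub, appLin_of, ← h] at h2
  simpa using Submodule.sub_mem _ h1 h2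

end Trivial

/-! ### Linear substitution into contexts of bracketed words -/

section TrivialCtx

variable {k : Type*} [Field k] {Z : Type*} {r : BWord Z → BWord Z → Prop}
  {S : Set (MonoidAlgebra k (BWord Z))}

theorem appLin_hole (a b : BWord Z) (f : MonoidAlgebra k (BWord Z)) :
    appLin Ctx.app (.hole a b) f = of k _ a * f * of k _ b := by
  suffices h : appLin Ctx.app (.hole a b) =
      LinearMap.mulRight k (of k _ b) ∘ₗ LinearMap.mulLeft k (of k _ a) from
    LinearMap.congr_fun h f
  refine linearMap_ext_of fun m => ?_
  simp only [appLin_of, LinearMap.comp_apply, LinearMap.mulLeft_apply, LinearMap.mulRight_apply,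
    Ctx.app, map_mul]

theorem appLin_hole_one (f : MonoidAlgebra k (BWord Z)) :
    appLin Ctx.app (.hole 1 1) f = f := by
  rw [appLin_hole, map_one, one_mul, mul_one]

/-- The context `⌊q⌋`. -/
def Ctx.br {Z : Type*} (q : Ctx Z) : Ctx Z := .nest 1 q 1

theorem Ctx.app_br (q : Ctx Z) (u : BWord Z) : q.br.app u = BWord.br (q.app u) := by
  simp only [Ctx.br, Ctx.app, one_mul, mul_one]

theorem appLin_br (q : Ctx Z) (f : MonoidAlgebra k (BWord Z)) :
    appLin Ctx.app q.br f = freeP k Z (appLin Ctx.app q f) := by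
  suffices h : appLin Ctx.app q.br = freeP k Z ∘ₗ appLin Ctx.app q from LinearMap.congr_fun h f
  refine linearMap_ext_of fun m => ?_
  rw [LinearMap.comp_apply, appLin_of, appLin_of, freeP_of, Ctx.app_br]

theorem appLin_comp (q p : Ctx Z) (f : MonoidAlgebra k (BWord Z)) :
    appLin Ctx.app (q.comp p) f = appLin Ctx.app q (appLin Ctx.app p f) := by
  suffices h : appLin Ctx.app (q.comp p) = appLin Ctx.app q ∘ₗ appLin Ctx.app p from
    LinearMap.congr_fun h f
  refine linearMap_ext_of fun m => ?_
  rw [LinearMap.comp_apply, appLin_of, appLin_of, appLin_of, Ctx.app_comp]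

/-- If `S` contains an element with leading monomial `1`, every element with monomials below `w`
is trivial modulo `(S, w)`. -/
theorem supported_le_trivialMod (hr : IsMonomialOrder Ctx.app r) {g : MonoidAlgebra k (BWord Z)}
    (hg : g ∈ S) (hg0 : g ≠ 0) (h1 : lead r g = 1) (w : BWord Z) :
    supported k k {m | r m w} ≤ trivialMod Ctx.app r S w := by
  have := hr.1
  -- As `lead r g = 1`, the word `m` is `m` times the monic multiple of `g`, minus terms below `m`,
  -- which the induction covers.
  have key : ∀ m, r m w → of k _ m ∈ trivialMod Ctx.app r S w := by
    intro m
    induction m using hr.1.wf.induction with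
    | _ m ih =>
    intro hm
    have h2 : appLin Ctx.app (.hole m 1) (monic r g - of k _ (lead r g)) ∈
        trivialMod Ctx.app r S w :=
      map_mem_of_mem_supported (monic_sub_lead_mem (r := r) hg0) _ fun m' hm' => by
        have hlt := hr.2 (.hole m 1) _ _ hm'
        simp only [h1, Ctx.app, mul_one] at hlt
        rw [appLin_of]
        simp only [Ctx.app, mul_one]
        exact ih _ hlt (trans_of r hlt hm)
    have h3 : appLin Ctx.app (.hole m 1) (monic r g) ∈ trivialMod Ctx.app r S w :=
      appLin_monic_mem_trivialMod hg (by simpa only [h1, Ctx.app, mul_one] using hm)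
    rw [map_sub, appLin_of, h1] at h2
    simpa [Ctx.app] using Submodule.sub_mem _ h3 h2
  intro f hf
  exact map_mem_of_mem_supported hf LinearMap.id key

theorem evalAlg_appLin {X : Type*} (θ : X → BWord Z) (q : Ctx X)
    (f : MonoidAlgebra k (BWord X)) :
    evalAlg (freeP k Z) (fun i => of k _ (θ i)) (appLin Ctx.app q f) =
      appLin Ctx.app (q.subst θ) (evalAlg (freeP k Z) (fun i => of k _ (θ i)) f) := by
  suffices h : (evalAlg (freeP k Z) (fun i => of k _ (θ i))).toLinearMap ∘ₗ appLin Ctx.app q =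
      appLin Ctx.app (q.subst θ) ∘ₗ (evalAlg (freeP k Z) (fun i => of k _ (θ i))).toLinearMap from
    LinearMap.congr_fun h f
  refine linearMap_ext_of fun m => ?_
  simp only [LinearMap.comp_apply, AlgHom.toLinearMap_apply, appLin_of, evalAlg_of, eval_of,
    Ctx.app_subst]

/-- The context found for words also computes the evaluation at polynomials, since both sides are
linear and agree on words. -/
theorem exists_ctx_eval {X : Type*} [DecidableEq X] {i : X} {m : BWord X} (hm : count i m = 1)
    (θ : X → BWord Z) :
    ∃ q : Ctx Z, (∀ a, eval br (Function.update θ i a) m = q.app a) ∧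
      ∀ f : MonoidAlgebra k (BWord Z),
        eval (freeP k Z) (Function.update (fun j => of k _ (θ j)) i f) m =
          appLin Ctx.app q f := by
  obtain ⟨q, hq⟩ := exists_ctx_eval_update hm θ
  obtain ⟨L, hL⟩ := exists_linearMap_eval_update hm (freeP k Z) (fun j => of k _ (θ j))
  refine ⟨q, hq, fun f => ?_⟩
  rw [hL]
  suffices h : L = appLin Ctx.app q from LinearMap.congr_fun h f
  refine linearMap_ext_of fun a => ?_
  rw [appLin_of, ← hq, ← eval_of, ← hL]
  congr 1
  funext j
  by_cases hj : j = i
  · subst hj; simp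
  · simp [Function.update_of_ne hj]

end TrivialCtx

/-! ### Rota–Baxter type identities and triviality -/

section RotaBaxter

variable {k : Type*} [Field k]

/-- The element `⌊x⌋⌊y⌋ - ⌊B(x, y)⌋`. -/
noncomputable def rbPoly (B : MonoidAlgebra k (BWord (Fin 2))) : MonoidAlgebra k (BWord (Fin 2)) :=
  of k _ (brbr (var 0) (var 1)) - freeP k (Fin 2) B

variable {B : MonoidAlgebra k (BWord (Fin 2))}

theorem evalAlg_rbPoly {A : Type*} [Ring A] [Algebra k A] (P : A →ₗ[k] A) (θ : Fin 2 → A) :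
    evalAlg P θ (rbPoly B) = P (θ 0) * P (θ 1) - P (evalAlg P θ B) := by
  rw [rbPoly, map_sub, evalAlg_of, evalAlg_freeP, brbr, eval_mul, eval_br, eval_br, eval_var,
    eval_var]

theorem eval₂_rbPoly {Z : Type*} (f g : MonoidAlgebra k (BWord Z)) :
    eval₂ (rbPoly B) f g = freeP k Z f * freeP k Z g - freeP k Z (eval₂ B f g) :=
  evalAlg_rbPoly _ _

theorem comp_vec2 {α β : Type*} (f : α → β) (a b : α) : ![f a, f b] = fun i => f (![a, b] i) := by
  funext i
  fin_cases i <;> rfl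

theorem evalAlg_comp_of {X Z : Type*} (f : MonoidAlgebra k (BWord X)) (θ : X → BWord Z) :
    evalAlg (freeP k Z) (fun i => of k _ (θ i)) f ∈
      supported k k {c | ∃ m, f.coeff m ≠ 0 ∧ c = eval br θ m} := by
  rw [evalAlg_eq_sum]
  refine Submodule.sum_mem _ fun m hm => Submodule.smul_mem _ _ ?_
  rw [eval_of]
  exact of_mem_supported ⟨m, Finsupp.mem_support_iff.1 hm, rfl⟩

theorem eval₂_of_mem {Z : Type*} (f : MonoidAlgebra k (BWord (Fin 2))) (a b : BWord Z) :
    eval₂ f (of k _ a) (of k _ b) ∈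
      supported k k {c | ∃ m, f.coeff m ≠ 0 ∧ c = eval br ![a, b] m} := by
  rw [eval₂, comp_vec2]
  exact evalAlg_comp_of f _

theorem mem_phiSet {φ : MonoidAlgebra k (BWord (Fin 2))} {Z : Type*} (θ : Fin 2 → BWord Z) :
    evalAlg (freeP k Z) (fun i => of k _ (θ i)) φ ∈ phiSet φ Z :=
  ⟨θ, rfl⟩

theorem evalAlg_eval₂ {X Z : Type*} (θ : X → BWord Z) (f g : MonoidAlgebra k (BWord X)) :
    evalAlg (freeP k Z) (fun i => of k _ (θ i)) (eval₂ B f g) =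
      eval₂ B (evalAlg (freeP k Z) (fun i => of k _ (θ i)) f)
        (evalAlg (freeP k Z) (fun i => of k _ (θ i)) g) := by
  rw [eval₂, map_evalAlg (P' := freeP k Z) _ (evalAlg_freeP _ _), eval₂]
  congr 2
  exact (comp_vec2 _ _ _).symm

/-- `⌊x⌋⌊y⌋` has breadth two, so it cannot cancel against a bracket. -/
theorem coeff_rbPoly_br (m : BWord (Fin 2)) : (rbPoly B).coeff (br m) = -B.coeff m := by
  have h1 : brbr (var 0) (var 1) ≠ br m := fun h => by
    simpa [breadth_brbr, breadth_br] using congrArg breadth h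
  have h2 : (freeP k (Fin 2) B).coeff (br m) = B.coeff m :=
    Finsupp.mapDomain_apply br_injective _ _
  simp [rbPoly, h1, h2]

theorem eq_br_of_mem_support_rbPoly {m : BWord (Fin 2)} (hm : m ∈ (rbPoly B).coeff.support)
    (hne : m ≠ brbr (var 0) (var 1)) : ∃ b ∈ B.coeff.support, m = br b := by
  classical
  rcases Finset.mem_union.1 (Finsupp.support_sub hm) with h | h
  · exact absurd (Finset.mem_singleton.1 (Finsupp.support_single_subset h)) hne
  · obtain ⟨b, hb, rfl⟩ := Finset.mem_image.1 (Finsupp.mapDomain_support h)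
    exact ⟨b, hb, rfl⟩

theorem IsLinearIn.rbPoly (hB : ∀ i, IsLinearIn i B) (i : Fin 2) : IsLinearIn i (rbPoly B) := by
  intro m hm
  by_cases hne : m = brbr (var 0) (var 1)
  · subst hne
    fin_cases i <;> rfl
  · obtain ⟨b, hb, rfl⟩ := eq_br_of_mem_support_rbPoly hm hne
    simp [br, count, hB i b hb]

/-! ### Triviality with respect to a reducing order -/

variable {Z : Type*} {r : BWord Z → BWord Z → Prop} {S : Set (MonoidAlgebra k (BWord Z))}

/-- `⌊b(u, v)⌋ < ⌊u⌋⌊v⌋` for all monomials `b` of `B` and all `u, v`. -/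
def IsReducing (B : MonoidAlgebra k (BWord (Fin 2))) (r : BWord Z → BWord Z → Prop) : Prop :=
  ∀ m, B.coeff m ≠ 0 → ∀ θ : Fin 2 → BWord Z, r (br (eval br θ m)) (brbr (θ 0) (θ 1))

theorem IsReducing.evalAlg_sub_mem (hB : IsReducing B r) (θ : Fin 2 → BWord Z) :
    evalAlg (freeP k Z) (fun i => of k _ (θ i)) (rbPoly B) - of k _ (brbr (θ 0) (θ 1)) ∈
      supported k k {m | r m (brbr (θ 0) (θ 1))} := by
  have h : freeP k Z (evalAlg (freeP k Z) (fun i => of k _ (θ i)) B) ∈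
      supported k k {m | r m (brbr (θ 0) (θ 1))} :=
    map_mem_of_mem_supported (evalAlg_comp_of B θ) _ fun c hc => by
      obtain ⟨m, hm, rfl⟩ := hc
      rw [freeP_of]
      exact of_mem_supported (hB m hm θ)
  rw [evalAlg_rbPoly, freeP_of, freeP_of, ← map_mul, ← brbr, sub_right_comm, sub_self, zero_sub]
  exact Submodule.neg_mem _ h

theorem IsReducing.lead_evalAlg (hr : IsMonomialOrder Ctx.app r)
    (hB : IsReducing B r) (θ : Fin 2 → BWord Z) :
    lead r (evalAlg (freeP k Z) (fun i => of k _ (θ i)) (rbPoly B)) = brbr (θ 0) (θ 1) :=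
  have := hr.1
  lead_eq_of_sub_mem (hB.evalAlg_sub_mem θ)

theorem IsReducing.monic_evalAlg (hr : IsMonomialOrder Ctx.app r)
    (hB : IsReducing B r) (θ : Fin 2 → BWord Z) :
    monic r (evalAlg (freeP k Z) (fun i => of k _ (θ i)) (rbPoly B)) =
      evalAlg (freeP k Z) (fun i => of k _ (θ i)) (rbPoly B) :=
  have := hr.1
  monic_eq_of_sub_mem (hB.evalAlg_sub_mem θ)

theorem IsReducing.evalAlg_ne_zero (hr : IsMonomialOrder Ctx.app r)
    (hB : IsReducing B r) (θ : Fin 2 → BWord Z) :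
    evalAlg (freeP k Z) (fun i => of k _ (θ i)) (rbPoly B) ≠ 0 := fun h => by
  have := hr.1
  have h1 := coeff_eq_one_of_sub_mem (hB.evalAlg_sub_mem θ)
  rw [h] at h1
  simp at h1

/-- `φ(f, v)` and `φ(u, f)` are trivial modulo `(S, w)` if the monomials of `f` are
small enough. -/
theorem evalAlg_update_mem (hr : IsMonomialOrder Ctx.app r)
    (hlin : ∀ i, IsLinearIn i B) (hB : IsReducing B r)
    (hS : phiSet (rbPoly B) Z ⊆ S) {w : BWord Z} (θ : Fin 2 → BWord Z) (i : Fin 2)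
    {f : MonoidAlgebra k (BWord Z)}
    (hf : f ∈ supported k k
      {u | r (eval br (Function.update θ i u) (brbr (var 0) (var 1))) w}) :
    evalAlg (freeP k Z) (Function.update (fun j => of k _ (θ j)) i f) (rbPoly B) ∈
      trivialMod Ctx.app r S w := by
  obtain ⟨L, hL⟩ := (IsLinearIn.rbPoly hlin i).exists_linearMap (freeP k Z)
    (fun j => of k _ (θ j))
  rw [hL]
  refine map_mem_of_mem_supported hf L fun u hu => ?_
  rw [← hL, show Function.update (fun j => of k (BWord Z) (θ j)) i (of k _ u) =
    fun j => of k _ (Function.update θ i u j) by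
      funext j
      by_cases hj : j = i
      · subst hj; simp
      · simp [Function.update_of_ne hj]]
  rw [Set.mem_ofPred_eq, eval_brbr] at hu
  rw [← appLin_hole_one (evalAlg _ _ _)]
  refine appLin_mem_trivialMod (hS (mem_phiSet _)) ?_
  rw [hB.lead_evalAlg hr]
  simpa only [Ctx.app, one_mul, mul_one] using hu

theorem eval₂_of_right_mem (hr : IsMonomialOrder Ctx.app r)
    (hlin : ∀ i, IsLinearIn i B) (hB : IsReducing B r)
    (hS : phiSet (rbPoly B) Z ⊆ S) {w v : BWord Z} {f : MonoidAlgebra k (BWord Z)}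
    (hf : f ∈ supported k k {u | r (brbr u v) w}) :
    eval₂ (rbPoly B) f (of k _ v) ∈ trivialMod Ctx.app r S w := by
  have := evalAlg_update_mem hr hlin hB hS (w := w) ![1, v] 0 (f := f) (by
    simpa [eval_brbr] using hf)
  rw [eval₂]
  convert this using 3
  funext i
  fin_cases i <;> rfl

theorem eval₂_of_left_mem (hr : IsMonomialOrder Ctx.app r)
    (hlin : ∀ i, IsLinearIn i B) (hB : IsReducing B r)
    (hS : phiSet (rbPoly B) Z ⊆ S) {w u : BWord Z} {f : MonoidAlgebra k (BWord Z)}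
    (hf : f ∈ supported k k {v | r (brbr u v) w}) :
    eval₂ (rbPoly B) (of k _ u) f ∈ trivialMod Ctx.app r S w := by
  have := evalAlg_update_mem hr hlin hB hS (w := w) ![u, 1] 1 (f := f) (by
    simpa [eval_brbr] using hf)
  rw [eval₂]
  convert this using 3
  funext i
  fin_cases i <;> rfl

/-- An element which rewrites to `0` is trivial, after every substitution. -/
theorem appLin_evalAlg_mem_of_rewrites (hr : IsMonomialOrder Ctx.app r)
    {X : Type*} (hB : IsReducing B r)
    (hS : phiSet (rbPoly B) Z ⊆ S) {w : BWord Z} (θ : X → BWord Z) (q : Ctx Z)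
    {f : MonoidAlgebra k (BWord X)} (h : Relation.ReflTransGen (RewriteStep B) f 0)
    (hf : f ∈ supported k k {m | r (q.app (eval br θ m)) w}) :
    appLin Ctx.app q (evalAlg (freeP k Z) (fun i => of k _ (θ i)) f) ∈
      trivialMod Ctx.app r S w := by
  have := hr.1
  induction h using Relation.ReflTransGen.head_induction_on with
  | refl => simp
  | @head f g hfg _ ih =>
    obtain ⟨p, a, b, hne, hg⟩ := hfg
    set c := f.coeff (p.app (brbr a b))
    -- The rewritten monomial occurs in `f`, so its image under `θ` and `q` is below `w`.
    have hlt : r ((q.comp (p.subst θ)).app (brbr (eval br θ a) (eval br θ b))) w := by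
      have h1 := mem_of_mem_supported hf hne
      rw [Set.mem_ofPred_eq, ← Ctx.app_subst] at h1
      rwa [Ctx.app_comp, ← show eval br θ (brbr a b) = brbr (eval br θ a) (eval br θ b) by
        simp only [brbr, eval_mul, eval_br]]
    -- The monomials that replace it are smaller still, since `IsReducing` holds under every
    -- substitution; the bound by `w` survives the step.
    have hred : appLin Ctx.app p (freeP k X (eval₂ B (of k _ a) (of k _ b))) ∈
        supported k k {m | r (q.app (eval br θ m)) w} := by
      refine map_mem_of_mem_supported (eval₂_of_mem B a b) (appLin Ctx.app p ∘ₗ freeP k X) ?_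
      rintro _ ⟨m, hm, rfl⟩
      rw [LinearMap.comp_apply, freeP_of, appLin_of]
      refine of_mem_supported (trans_of r ?_ hlt)
      rw [← Ctx.app_subst, eval_br, eval_eval, ← Ctx.app_comp]
      refine hr.2 _ _ _ ?_
      have h2 := hB m hm fun i => eval br θ (![a, b] i)
      simpa using h2
    have hg' : g ∈ supported k k {m | r (q.app (eval br θ m)) w} := by
      rw [hg]
      refine Submodule.add_mem _ (Submodule.sub_mem _ hf (Submodule.smul_mem _ _ ?_))
        (Submodule.smul_mem _ _ hred)
      exact of_mem_supported (mem_of_mem_supported hf hne)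
    -- A rewriting step subtracts a multiple of `p|_{φ(a,b)}`, which remains of this shape after the
    -- substitution `θ`.
    have hfg : f = g + c • appLin Ctx.app p (eval₂ (rbPoly B) (of k _ a) (of k _ b)) := by
      rw [hg, eval₂_rbPoly, freeP_of, freeP_of, ← map_mul, ← brbr, map_sub, appLin_of, smul_sub]
      abel
    rw [hfg, map_add, map_add, map_smul, map_smul]
    refine Submodule.add_mem _ (ih hg') (Submodule.smul_mem _ _ ?_)
    rw [evalAlg_appLin, ← appLin_comp, evalAlg_eval₂, evalAlg_of, evalAlg_of, eval_of, eval_of,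
      eval₂, comp_vec2]
    refine appLin_mem_trivialMod (hS (mem_phiSet _)) ?_
    rw [hB.lead_evalAlg hr]
    exact hlt

/-- Applying `IsReducing` twice gives `⌊b'(b(u,v),w)⌋ < ⌊b(u,v)⌋⌊w⌋ < ⌊u⌋⌊v⌋⌊w⌋`. -/
theorem eval₂_eval₂_left_mem (hr : IsMonomialOrder Ctx.app r)
    (hlin : ∀ i, IsLinearIn i B) (hB : IsReducing B r) {X : Type*}
    (θ : X → BWord Z) (a b c : BWord X) :
    eval₂ B (eval₂ B (of k _ a) (of k _ b)) (of k _ c) ∈ supported k k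
      {m | r (br (eval br θ m)) (brbr (eval br θ a) (eval br θ b) * br (eval br θ c))} := by
  have := hr.1
  obtain ⟨L, hL⟩ := (hlin 0).exists_linearMap_left (freeP k X) (of k _ c)
  rw [eval₂, hL]
  refine map_mem_of_mem_supported (eval₂_of_mem B a b) L ?_
  rintro _ ⟨m, hm, rfl⟩
  rw [← hL]
  refine supported_mono ?_ (eval₂_of_mem B (eval br ![a, b] m) c)
  rintro _ ⟨m', hm', rfl⟩
  have h1 := hB m' hm' fun i => eval br θ (![eval br ![a, b] m, c] i)
  have h2 := hB m hm fun i => eval br θ (![a, b] i)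
  rw [Set.mem_ofPred_eq, eval_eval]
  refine trans_of r h1 ?_
  have h3 := hr.2 (.hole 1 (br (eval br θ c))) _ _ h2
  rw [← eval_eval] at h3
  simpa [Ctx.app, brbr] using h3

theorem eval₂_eval₂_right_mem (hr : IsMonomialOrder Ctx.app r)
    (hlin : ∀ i, IsLinearIn i B) (hB : IsReducing B r) {X : Type*}
    (θ : X → BWord Z) (a b c : BWord X) :
    eval₂ B (of k _ a) (eval₂ B (of k _ b) (of k _ c)) ∈ supported k k
      {m | r (br (eval br θ m)) (brbr (eval br θ a) (eval br θ b) * br (eval br θ c))} := by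
  have := hr.1
  obtain ⟨L, hL⟩ := (hlin 1).exists_linearMap_right (freeP k X) (of k _ a)
  rw [eval₂, hL]
  refine map_mem_of_mem_supported (eval₂_of_mem B b c) L ?_
  rintro _ ⟨m, hm, rfl⟩
  rw [← hL]
  refine supported_mono ?_ (eval₂_of_mem B a (eval br ![b, c] m))
  rintro _ ⟨m', hm', rfl⟩
  have h1 := hB m' hm' fun i => eval br θ (![a, eval br ![b, c] m] i)
  have h2 := hB m hm fun i => eval br θ (![b, c] i)
  rw [Set.mem_ofPred_eq, eval_eval]
  refine trans_of r h1 ?_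
  have h3 := hr.2 (.hole (br (eval br θ a)) 1) _ _ h2
  rw [← eval_eval] at h3
  simpa [Ctx.app, brbr, mul_assoc] using h3

/-- The intersection compositions of elements of `S_φ(Z)` are trivial. -/
theorem overlap_mem (hr : IsMonomialOrder Ctx.app r)
    (hlin : ∀ i, IsLinearIn i B) (hB : IsReducing B r)
    (hS : phiSet (rbPoly B) Z ⊆ S) {X : Type*} (θ : X → BWord Z) (i j l : X)
    (h : Relation.ReflTransGen (RewriteStep B)
      (eval₂ B (eval₂ B (of k _ (var i)) (of k _ (var j))) (of k _ (var l)) -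
        eval₂ B (of k _ (var i)) (eval₂ B (of k _ (var j)) (of k _ (var l)))) 0) :
    eval₂ (rbPoly B) (of k _ (θ i)) (of k _ (θ j)) * of k _ (br (θ l)) -
      of k _ (br (θ i)) * eval₂ (rbPoly B) (of k _ (θ j)) (of k _ (θ l)) ∈
    trivialMod Ctx.app r S (brbr (θ i) (θ j) * br (θ l)) := by
  have := hr.1
  have h1 : eval₂ (rbPoly B) (eval₂ B (of k _ (θ i)) (of k _ (θ j))) (of k _ (θ l)) ∈
      trivialMod Ctx.app r S (brbr (θ i) (θ j) * br (θ l)) := by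
    refine eval₂_of_right_mem hr hlin hB hS (supported_mono ?_ (eval₂_of_mem B _ _))
    rintro _ ⟨m, hm, rfl⟩
    have h3 := hr.2 (.hole 1 (br (θ l))) _ _ (hB m hm ![θ i, θ j])
    simpa [Ctx.app, brbr] using h3
  have h2 : eval₂ (rbPoly B) (of k _ (θ i)) (eval₂ B (of k _ (θ j)) (of k _ (θ l))) ∈
      trivialMod Ctx.app r S (brbr (θ i) (θ j) * br (θ l)) := by
    refine eval₂_of_left_mem hr hlin hB hS (supported_mono ?_ (eval₂_of_mem B _ _))
    rintro _ ⟨m, hm, rfl⟩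
    have h3 := hr.2 (.hole (br (θ i)) 1) _ _ (hB m hm ![θ j, θ l])
    simpa [Ctx.app, brbr, mul_assoc] using h3
  have h3 := appLin_evalAlg_mem_of_rewrites hr hB hS
    (w := brbr (θ i) (θ j) * br (θ l)) θ (Ctx.hole 1 1).br h (by
      have h4 := Submodule.sub_mem _ (eval₂_eval₂_left_mem hr hlin hB θ (var i) (var j) (var l))
        (eval₂_eval₂_right_mem hr hlin hB θ (var i) (var j) (var l))
      simpa only [eval_var, Ctx.app_br, Ctx.app, one_mul, mul_one] using h4)
  rw [appLin_br, appLin_hole_one, map_sub, evalAlg_eval₂, evalAlg_eval₂, evalAlg_eval₂,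
    evalAlg_eval₂, evalAlg_of, evalAlg_of, evalAlg_of, eval_var, eval_var, eval_var,
    map_sub] at h3
  -- The composition equals `φ(u,B(v,w)) - φ(B(u,v),w) - ⌊B(B(u,v),w) - B(u,B(v,w))⌋`; the products
  -- `⌊u⌋⌊v⌋⌊w⌋` cancel.
  have h4 := Submodule.sub_mem _ (Submodule.sub_mem _ h2 h1) h3
  convert h4 using 1
  simp only [eval₂_rbPoly, freeP_of]
  noncomm_ring

/-- The inclusion compositions of elements of `S_φ(Z)` with nested elements of `S` are
trivial. -/
theorem nested_mem (hr : IsMonomialOrder Ctx.app r)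
    (hlin : ∀ i, IsLinearIn i B) (hB : IsReducing B r)
    (hS : phiSet (rbPoly B) Z ⊆ S) {s : MonoidAlgebra k (BWord Z)} (hs : s ∈ S) (hs0 : s ≠ 0)
    (θ : Fin 2 → BWord Z) (i : Fin 2) (p q : Ctx Z) (hp : θ i = p.app (lead r s))
    (hq : ∀ a, q.app a =
      eval br (Function.update θ i (p.app a)) (brbr (var 0) (var 1))) :
    evalAlg (freeP k Z) (fun j => of k _ (θ j)) (rbPoly B) - appLin Ctx.app q (monic r s) ∈
      trivialMod Ctx.app r S (brbr (θ 0) (θ 1)) := by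
  have := hr.1
  have hθ : eval br (Function.update θ i (p.app (lead r s))) (brbr (var 0) (var 1)) =
      brbr (θ 0) (θ 1) := by
    rw [← hp, Function.update_eq_self, eval_brbr]
  set t := monic r s - of k _ (lead r s) with ht
  have ht' : appLin Ctx.app p t ∈ supported k k
      {u | r (eval br (Function.update θ i u) (brbr (var 0) (var 1))) (brbr (θ 0) (θ 1))} := by
    refine map_mem_of_mem_supported (monic_sub_lead_mem (r := r) hs0) _ fun m hm => ?_
    rw [appLin_of]
    refine of_mem_supported ?_
    rw [Set.mem_ofPred_eq, ← hθ, ← hq, ← hq]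
    exact hr.2 _ _ _ hm
  have h1 := evalAlg_update_mem hr hlin hB hS θ i ht'
  obtain ⟨L, hL⟩ := (IsLinearIn.rbPoly hlin i).exists_linearMap (freeP k Z)
    (fun j => of k _ (θ j))
  -- For each monomial `m` of `B` this is a context applied to the monic `s`, with leading word
  -- `⌊m(θ)⌋` below `⌊θ 0⌋⌊θ 1⌋`.
  have h2 : freeP k Z (evalAlg (freeP k Z) (Function.update (fun j => of k _ (θ j)) i
      (appLin Ctx.app p (monic r s))) B) ∈ trivialMod Ctx.app r S (brbr (θ 0) (θ 1)) := by
    rw [evalAlg_eq_sum, map_sum]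
    refine Submodule.sum_mem _ fun m hm => ?_
    rw [map_smul]
    refine Submodule.smul_mem _ _ ?_
    obtain ⟨c, hc, hc'⟩ := exists_ctx_eval (k := k) (hlin i m hm) θ
    rw [hc', ← appLin_comp, ← appLin_br]
    refine appLin_monic_mem_trivialMod hs ?_
    rw [Ctx.app_br, Ctx.app_comp, ← hp, ← hc, Function.update_eq_self]
    exact hB m (Finsupp.mem_support_iff.1 hm) θ
  have h3 : appLin Ctx.app q (monic r s) = eval (freeP k Z) (Function.update
      (fun j => of k _ (θ j)) i (appLin Ctx.app p (monic r s))) (brbr (var 0) (var 1)) := by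
    obtain ⟨c, hc, hc'⟩ := exists_ctx_eval (k := k) (i := i) (m := brbr (var 0) (var 1))
      (by fin_cases i <;> rfl) θ
    rw [hc', ← appLin_comp]
    refine LinearMap.congr_fun (appLin_congr fun u => ?_) _
    rw [Ctx.app_comp, ← hc, hq]
  have h4 : evalAlg (freeP k Z) (fun j => of k _ (θ j)) (rbPoly B) =
      L (appLin Ctx.app p (of k _ (lead r s))) := by
    rw [appLin_of, ← hp, ← hL, Function.update_eq_self_iff.2 rfl]
  have h5 : L (appLin Ctx.app p (monic r s)) = appLin Ctx.app q (monic r s) -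
      freeP k Z (evalAlg (freeP k Z) (Function.update (fun j => of k _ (θ j)) i
      (appLin Ctx.app p (monic r s))) B) := by
    rw [← hL, h3, rbPoly, map_sub, evalAlg_of, evalAlg_freeP]
  rw [hL] at h1
  rw [ht, map_sub, map_sub, ← h4, h5] at h1
  -- Up to sign the composition is `φ` at `p|_t` (that is `h1`) plus the bracket of `B` at `p|_s`
  -- (that is `h2`), with `s` made monic and `t` its part below the leading monomial.
  convert Submodule.neg_mem _ (Submodule.add_mem _ h1 h2) using 1
  abel

end RotaBaxter

/-! ### Transfer of Gröbner–Shirshov bases from `k𝓜(Z)` to `k𝔐(Z)` -/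

section Transfer

variable {k : Type*} [Field k] {Z : Type*} {r : BWord Z → BWord Z → Prop}
  {r₀ : FreeMonoid Z → FreeMonoid Z → Prop}

theorem coeff_incl_ofFree (f : MonoidAlgebra k (FreeMonoid Z)) (m : FreeMonoid Z) :
    (incl k Z f).coeff (ofFree Z m) = f.coeff m :=
  Finsupp.mapDomain_apply ofFree_injective _ _

theorem isWellOrder_of_ofFree (hr : IsWellOrder (BWord Z) r)
    (hr₀ : ∀ a b, r (ofFree Z a) (ofFree Z b) ↔ r₀ a b) : IsWellOrder (FreeMonoid Z) r₀ :=
  RelEmbedding.isWellOrder (⟨⟨ofFree Z, ofFree_injective⟩, hr₀ _ _⟩ : r₀ ↪r r)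

theorem lead_incl (hr : IsWellOrder (BWord Z) r)
    (hr₀ : ∀ a b, r (ofFree Z a) (ofFree Z b) ↔ r₀ a b) (f : MonoidAlgebra k (FreeMonoid Z)) :
    lead r (incl k Z f) = ofFree Z (lead r₀ f) := by
  classical
  have := isWellOrder_of_ofFree hr hr₀
  -- For `f = 0` both leading monomials are `1` by convention.
  by_cases hf : f = 0
  · rw [hf, map_zero, lead_zero, lead_zero, map_one]
  obtain ⟨h1, h2⟩ := lead_spec (r := r₀) hf
  refine lead_eq_of_forall (by rwa [coeff_incl_ofFree]) fun m hm hne => ?_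
  obtain ⟨m, -, rfl⟩ := Finset.mem_image.1
    (Finsupp.mapDomain_support (Finsupp.mem_support_iff.2 hm))
  exact (hr₀ _ _).2 (h2 m (by rwa [← coeff_incl_ofFree]) fun h => hne (by rw [h]))

theorem monic_incl (hr : IsWellOrder (BWord Z) r)
    (hr₀ : ∀ a b, r (ofFree Z a) (ofFree Z b) ↔ r₀ a b) (f : MonoidAlgebra k (FreeMonoid Z)) :
    monic r (incl k Z f) = incl k Z (monic r₀ f) := by
  rw [monic, monic, lead_incl hr hr₀, coeff_incl_ofFree, map_smul]

theorem incl_appLin (q : FreeMonoid Z × FreeMonoid Z) (f : MonoidAlgebra k (FreeMonoid Z)) :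
    incl k Z (appLin freeApp q f) =
      appLin Ctx.app (.hole (ofFree Z q.1) (ofFree Z q.2)) (incl k Z f) := by
  suffices h : (incl k Z).toLinearMap ∘ₗ appLin freeApp q =
      appLin Ctx.app (.hole (ofFree Z q.1) (ofFree Z q.2)) ∘ₗ (incl k Z).toLinearMap from
    LinearMap.congr_fun h f
  refine linearMap_ext_of fun m => ?_
  simp only [LinearMap.comp_apply, AlgHom.toLinearMap_apply, appLin_of, incl_of, freeApp, Ctx.app,
    map_mul]

theorem incl_mem_trivialMod (hr : IsWellOrder (BWord Z) r)
    (hr₀ : ∀ a b, r (ofFree Z a) (ofFree Z b) ↔ r₀ a b)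
    {G : Set (MonoidAlgebra k (FreeMonoid Z))} {S : Set (MonoidAlgebra k (BWord Z))}
    (hS : incl k Z '' G ⊆ S) {w : FreeMonoid Z} {f : MonoidAlgebra k (FreeMonoid Z)}
    (hf : IsTrivialMod freeApp r₀ G w f) :
    incl k Z f ∈ trivialMod Ctx.app r S (ofFree Z w) := by
  refine (Submodule.span_le.2 ?_ :
    _ ≤ (trivialMod Ctx.app r S (ofFree Z w)).comap (incl k Z).toLinearMap) hf
  rintro _ ⟨q, s, hs, hlt, rfl⟩
  change incl k Z _ ∈ trivialMod Ctx.app r S (ofFree Z w)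
  rw [incl_appLin]
  refine appLin_mem_trivialMod (hS ⟨s, hs, rfl⟩) ?_
  rw [lead_incl hr hr₀]
  simpa [Ctx.app, freeApp] using (hr₀ _ _).2 hlt

/-- The preimage of an operated ideal under `incl` is a two-sided ideal, so it contains `I` as soon
as it contains `G`. -/
theorem opIdeal_union_image_eq (φ : Set (MonoidAlgebra k (BWord Z)))
    {G : Set (MonoidAlgebra k (FreeMonoid Z))} {I : TwoSidedIdeal (MonoidAlgebra k (FreeMonoid Z))}
    (hG : TwoSidedIdeal.span G = I) :
    opIdeal (freeP k Z) (φ ∪ incl k Z '' G) = opIdeal (freeP k Z) (φ ∪ incl k Z '' I) := by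
  subst hG
  apply le_antisymm
  · refine opIdeal_le (fun a ha => subset_opIdeal _ _ ?_) fun a => map_mem_opIdeal _ _
    exact ha.imp_right fun h => Set.image_mono TwoSidedIdeal.subset_span h
  · refine opIdeal_le ?_ fun a => map_mem_opIdeal _ _
    rintro a (ha | ⟨b, hb, rfl⟩)
    · exact subset_opIdeal _ _ (.inl ha)
    · have h : TwoSidedIdeal.span G ≤
          (opIdeal (freeP k Z) (φ ∪ incl k Z '' G)).comap (incl k Z) :=
        TwoSidedIdeal.span_le.2 fun c hc =>
          (TwoSidedIdeal.mem_comap (incl k Z)).2 (subset_opIdeal _ _ (.inr ⟨c, hc, rfl⟩))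
      exact (TwoSidedIdeal.mem_comap (incl k Z)).1 (h hb)

end Transfer

/-! ### The operated Gröbner–Shirshov basis -/

section Basis

variable {k : Type*} [Field k] {Z : Type u} {r : BWord Z → BWord Z → Prop}
  {r₀ : FreeMonoid Z → FreeMonoid Z → Prop} {B : MonoidAlgebra k (BWord (Fin 2))}

/-- The inclusion compositions of an element of `S_φ(Z)` with elements of `S_φ(Z) ∪ G`. -/
theorem inclusion_mem (hr : IsMonomialOrder Ctx.app r)
    (hr₀ : ∀ a b, r (ofFree Z a) (ofFree Z b) ↔ r₀ a b)
    (hlin : ∀ i, IsLinearIn i B) (hB : IsReducing B r)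
    {G : Set (MonoidAlgebra k (FreeMonoid Z))} (θ : Fin 2 → BWord Z)
    {g : MonoidAlgebra k (BWord Z)} (hg : g ∈ phiSet (rbPoly B) Z ∪ incl k Z '' G) (hg0 : g ≠ 0)
    (q : Ctx Z) (hq : brbr (θ 0) (θ 1) = q.app (lead r g)) :
    evalAlg (freeP k Z) (fun j => of k _ (θ j)) (rbPoly B) - appLin Ctx.app q (monic r g) ∈
      trivialMod Ctx.app r (phiSet (rbPoly B) Z ∪ incl k Z '' G) (brbr (θ 0) (θ 1)) := by
  have := hr.1
  -- The empty word divides every word in many ways, so the position of `⋆` carries no information;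
  -- but then every polynomial with monomials below `w` is trivial.
  by_cases h1 : lead r g = 1
  · refine supported_le_trivialMod hr hg hg0 h1 _ ?_
    have h2 := monic_sub_appLin_monic_mem hr (hB.evalAlg_ne_zero hr θ) hg0
      (by rw [hB.lead_evalAlg hr, hq])
    rwa [hB.monic_evalAlg hr, hB.lead_evalAlg hr] at h2
  cases q with
  | nest a p b =>
    obtain ⟨rfl, hp, rfl⟩ | ⟨rfl, hp, rfl⟩ := mul_br_mul_eq_brbr hq.symm
    · refine nested_mem hr hlin hB Set.subset_union_left hg hg0 θ 0 p _ hp.symm fun u => ?_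
      rw [eval_brbr]
      simp [Ctx.app, brbr]
    · refine nested_mem hr hlin hB Set.subset_union_left hg hg0 θ 1 p _ hp.symm fun u => ?_
      rw [eval_brbr]
      simp [Ctx.app, brbr]
  | hole a b =>
    rcases hg with ⟨η, rfl⟩ | ⟨g, hg, rfl⟩
    · rw [hB.lead_evalAlg hr] at hq
      obtain ⟨rfl, rfl, h0, h1⟩ := mul_brbr_mul_eq_brbr hq.symm
      have : η = θ := by
        funext i
        fin_cases i
        · exact h0
        · exact h1
      rw [this, appLin_hole_one, hB.monic_evalAlg hr, sub_self]
      exact Submodule.zero_mem _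
    · rw [lead_incl hr.1 hr₀] at hq h1
      rw [mul_ofFree_mul_eq_brbr hq.symm, map_one] at h1
      exact absurd rfl h1

theorem isGSBasis_union (hr : IsMonomialOrder Ctx.app r)
    (hr₀ : ∀ a b, r (ofFree Z a) (ofFree Z b) ↔ r₀ a b)
    (hlin : ∀ i, IsLinearIn i B) (hB : IsReducing B r)
    (hrew : ∀ (X : Type u) (a b c : BWord X), a ≠ 1 → b ≠ 1 → c ≠ 1 →
      Relation.ReflTransGen (RewriteStep B)
        (eval₂ B (eval₂ B (of k _ a) (of k _ b)) (of k _ c) -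
          eval₂ B (of k _ a) (eval₂ B (of k _ b) (of k _ c))) 0)
    {G : Set (MonoidAlgebra k (FreeMonoid Z))} (hG : IsGSBasis freeApp FreeMonoid.length r₀ G) :
    IsGSBasis Ctx.app breadth r (phiSet (rbPoly B) Z ∪ incl k Z '' G) := by
  rintro _ (⟨θ, rfl⟩ | ⟨f, hf, rfl⟩) g hg hf0 hg0
  · refine ⟨fun w a b hw1 hw2 h2 h4 => ?_, fun w q hw1 hw2 => ?_⟩
    · rcases hg with ⟨η, rfl⟩ | ⟨g, hg, rfl⟩
      · rw [hB.lead_evalAlg hr, breadth_brbr, hB.lead_evalAlg hr, breadth_brbr] at h2 h4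
        rw [hB.lead_evalAlg hr] at hw1 hw2
        subst hw1
        obtain ⟨rfl, h1, rfl⟩ := brbr_mul_eq_mul_brbr hw2 h2 h4
        rw [hB.monic_evalAlg hr, hB.monic_evalAlg hr]
        -- The rewriting hypothesis is applied to three distinct letters, which are nonempty,
        -- whereas `θ 0`, `θ 1`, `η 1` may be empty. `ULift` moves `Fin 3` to the universe of the
        -- hypothesis.
        have h3 := overlap_mem hr hlin hB (S := phiSet (rbPoly B) Z ∪ incl k Z '' G)
          Set.subset_union_left (X := ULift (Fin 3)) (fun i => ![θ 0, θ 1, η 1] i.down)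
          ⟨0⟩ ⟨1⟩ ⟨2⟩ (hrew _ _ _ _ nofun nofun nofun)
        have hθ : eval₂ (rbPoly B) (of k _ (θ 0)) (of k _ (θ 1)) =
            evalAlg (freeP k Z) (fun i => of k _ (θ i)) (rbPoly B) := by
          rw [eval₂, comp_vec2]
          congr 2
          funext i
          fin_cases i <;> rfl
        have hη : eval₂ (rbPoly B) (of k _ (θ 1)) (of k _ (η 1)) =
            evalAlg (freeP k Z) (fun i => of k _ (η i)) (rbPoly B) := by
          rw [eval₂, comp_vec2]
          congr 2
          funext i
          fin_cases i
          · exact congrArg _ h1.symm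
          · rfl
        rw [← hθ, ← hη]
        exact h3
      · rw [lead_incl hr.1 hr₀, breadth_ofFree, hB.lead_evalAlg hr, breadth_brbr] at h2 h4
        rw [hB.lead_evalAlg hr] at hw1
        rw [lead_incl hr.1 hr₀] at hw2
        subst hw1
        exact absurd hw2 (brbr_mul_ne_mul_ofFree h2 h4)
    · rw [hB.lead_evalAlg hr] at hw1
      subst hw1
      rw [hB.monic_evalAlg hr]
      exact inclusion_mem hr hr₀ hlin hB θ hg hg0 q hw2
  · rcases hg with ⟨η, rfl⟩ | ⟨g, hg, rfl⟩
    · refine ⟨fun w a b hw1 hw2 h2 h4 => ?_, fun w q hw1 hw2 => ?_⟩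
      · rw [lead_incl hr.1 hr₀, breadth_ofFree, hB.lead_evalAlg hr, breadth_brbr] at h2 h4
        rw [lead_incl hr.1 hr₀] at hw1
        rw [hB.lead_evalAlg hr] at hw2
        subst hw1
        exact absurd hw2 (ofFree_mul_ne_mul_brbr h2 h4)
      · rw [lead_incl hr.1 hr₀] at hw1
        rw [hB.lead_evalAlg hr] at hw2
        -- A leading monomial from `G` has degree zero, so it cannot contain `⌊u⌋⌊v⌋`, of degree at
        -- least two.
        have h1 := degP_le_degP_app q (brbr (η 0) (η 1))
        rw [← hw2, hw1, degP_ofFree, degP_brbr] at h1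
        omega
    · obtain ⟨hint, hinc⟩ := hG f hf g hg (fun h => hf0 (by rw [h, map_zero]))
        (fun h => hg0 (by rw [h, map_zero]))
      refine ⟨fun w a b hw1 hw2 h2 h4 => ?_, fun w q hw1 hw2 => ?_⟩
      · simp only [lead_incl hr.1 hr₀, breadth_ofFree] at h2 h4 hw1 hw2
        subst hw1
        obtain ⟨c, d, rfl, rfl, hcd⟩ := exists_ofFree_of_overlap hw2 h4
        rw [← map_mul, breadth_ofFree] at h2 h4
        have h1 := incl_mem_trivialMod hr.1 hr₀ (S := phiSet (rbPoly B) Z ∪ incl k Z '' G)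
          Set.subset_union_right (hint _ c d rfl hcd h2 h4)
        rw [monic_incl hr.1 hr₀, monic_incl hr.1 hr₀, ← incl_of, ← incl_of, ← map_mul,
          ← map_mul, ← map_mul, ← map_sub]
        exact h1
      · simp only [lead_incl hr.1 hr₀] at hw1 hw2
        subst hw1
        obtain ⟨a, b, rfl⟩ := exists_of_app_eq_ofFree hw2.symm
        have h1 := incl_mem_trivialMod hr.1 hr₀ (S := phiSet (rbPoly B) Z ∪ incl k Z '' G)
          Set.subset_union_right (hinc _ (a, b) rfl (ofFree_injective (by
            simpa [Ctx.app, freeApp] using hw2)))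
        rw [map_sub, incl_appLin] at h1
        rw [monic_incl hr.1 hr₀, monic_incl hr.1 hr₀]
        exact h1

theorem isReducing_of_forall_support
    (h : ∀ m ∈ (rbPoly B).coeff.support, m ≠ brbr (var 0) (var 1) →
      ∀ a b : BWord Z, r (eval br ![a, b] m) (brbr a b)) : IsReducing B r := by
  intro m hm θ
  have h1 := h (br m) (by rw [Finsupp.mem_support_iff, coeff_rbPoly_br]; simpa using hm)
    (fun h => by simpa [breadth_brbr, breadth_br] using congrArg breadth h) (θ 0) (θ 1)
  rw [eval_br] at h1
  convert h1 using 3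
  funext i
  fin_cases i <;> rfl

/-- If `⌊x⌋⌊y⌋` is the leading monomial of `φ` for `<_db`, it is so under all substitutions. -/
theorem dbLt_eval_of_lead_eq [LinearOrder Z] (hlin : ∀ i, IsLinearIn i B)
    (hlead : lead DbLt (rbPoly B) = brbr (var 0) (var 1)) {m : BWord (Fin 2)}
    (hm : m ∈ (rbPoly B).coeff.support) (hne : m ≠ brbr (var 0) (var 1)) (a b : BWord Z) :
    DbLt (eval br ![a, b] m) (brbr a b) := by
  have := (isMonomialOrder_dbLt (Z := Fin 2)).1
  have hm0 := Finsupp.mem_support_iff.1 hm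
  have h1 := (lead_spec (r := DbLt) (f := rbPoly B) fun h => hm0 (by rw [h]; rfl)).2 m hm0
    (by rwa [hlead])
  rw [hlead, dbLt_iff] at h1
  -- The bound is the degree of `⌊x⌋⌊y⌋`.
  have hle : degP m ≤ 2 := h1.elim le_of_lt fun h => h.1.le
  obtain ⟨c, hc, rfl⟩ := eq_br_of_mem_support_rbPoly hm hne
  -- Each variable occurs once in `c`, so the substitution adds `degP a + degP b`, exactly as for
  -- `⌊x⌋⌊y⌋`.
  have hd : degP (eval br ![a, b] (br c)) = degP (br c) + degP a + degP b := by
    rw [eval_br, degP_br, degP_eval, hlin 0 c hc, hlin 1 c hc, degP_br]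
    simp
    omega
  have hd' := degP_brbr a b
  rcases lt_or_eq_of_le hle with h | h
  · exact .deg (by omega)
  -- In equal degree, one outer bracket loses to two.
  · refine .breadth (by omega) ?_
    rw [eval_br]
    exact Nat.one_lt_two

end Basis

end OperatedGS

/-! ### The main theorem -/

theorem mainTheorem3 {k : Type v} [Field k] {Z : Type u}
    (φ : MonoidAlgebra k (BWord (Fin 2))) (hφ : IsRotaBaxterType.{u, v} φ)
    (I : TwoSidedIdeal (MonoidAlgebra k (FreeMonoid Z))) :
    -- the free `φ`-algebra over `A = k𝓜(Z) / I`
    (∃ i : I.ringCon.Quotient →ₐ[k]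
        (opIdeal (freeP k Z) (phiSet φ Z ∪ incl k Z '' I)).ringCon.Quotient,
      (∀ f : MonoidAlgebra k (FreeMonoid Z), i (f : I.ringCon.Quotient) = (incl k Z f :
        (opIdeal (freeP k Z) (phiSet φ Z ∪ incl k Z '' I)).ringCon.Quotient)) ∧
      IsFreePhiAlgebraOver.{w} φ (quotP (freeP k Z) (phiSet φ Z ∪ incl k Z '' I)) i) ∧
    -- operated Gröbner–Shirshov bases
    (∀ [LinearOrder Z] [WellFoundedLT Z],
      -- `<_db` is a monomial order on `𝔐(Z)` which restricts to the degree lexicographical order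
      (IsMonomialOrder Ctx.app (DbLt (Z := Z)) ∧
        ∀ a b : FreeMonoid Z, DbLt (BWord.ofFree Z a) (BWord.ofFree Z b) ↔ dlexLt a b) ∧
      ∀ G : Set (MonoidAlgebra k (FreeMonoid Z)), IsGSBasisOf dlexLt G I →
        -- the order `<_db`
        (lead DbLt φ = brbr (BWord.var 0) (BWord.var 1) →
          IsOperatedGSBasisOf DbLt (phiSet φ Z ∪ incl k Z '' G)
            (opIdeal (freeP k Z) (phiSet φ Z ∪ incl k Z '' I))) ∧
        -- any monomial order which extends the degree lexicographical order and for which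
        -- `⌊x⌋⌊y⌋` is the leading monomial of `φ` under all substitutions
        (∀ r : BWord Z → BWord Z → Prop, IsMonomialOrder Ctx.app r →
          (∀ a b : FreeMonoid Z, r (BWord.ofFree Z a) (BWord.ofFree Z b) ↔ dlexLt a b) →
          (∀ m ∈ φ.coeff.support, m ≠ brbr (BWord.var 0) (BWord.var 1) →
            ∀ a b : BWord Z, r (BWord.eval BWord.br ![a, b] m) (brbr a b)) →
          IsOperatedGSBasisOf r (phiSet φ Z ∪ incl k Z '' G)
            (opIdeal (freeP k Z) (phiSet φ Z ∪ incl k Z '' I)))) := by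
  obtain ⟨B, hφB, hcount, -, -, hrew⟩ := hφ
  obtain rfl : φ = rbPoly B := hφB
  have hlin : ∀ i, IsLinearIn i B := fun i m hm => hcount m hm i
  refine ⟨exists_isFreePhiAlgebraOver (IsLinearIn.rbPoly hlin) I, ?_⟩
  intro _ _
  refine ⟨⟨isMonomialOrder_dbLt, dbLt_ofFree_iff⟩, fun G hG => ?_⟩
  -- The statement for general orders contains the one for `DbLt`.
  have key : ∀ r : BWord Z → BWord Z → Prop, IsMonomialOrder Ctx.app r →
      (∀ a b : FreeMonoid Z, r (BWord.ofFree Z a) (BWord.ofFree Z b) ↔ dlexLt a b) →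
      (∀ m ∈ (rbPoly B).coeff.support, m ≠ brbr (BWord.var 0) (BWord.var 1) →
        ∀ a b : BWord Z, r (BWord.eval BWord.br ![a, b] m) (brbr a b)) →
      IsOperatedGSBasisOf r (phiSet (rbPoly B) Z ∪ incl k Z '' G)
        (opIdeal (freeP k Z) (phiSet (rbPoly B) Z ∪ incl k Z '' I)) := fun r hr hr₀ h =>
    ⟨isGSBasis_union hr hr₀ hlin (isReducing_of_forall_support h) hrew hG.1,
      opIdeal_union_image_eq _ hG.2⟩
  exact ⟨fun hlead => key _ isMonomialOrder_dbLt dbLt_ofFree_iff fun m hm hne a b =>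
    dbLt_eval_of_lead_eq hlin hlead hm hne a b, key⟩
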